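/- **Setting.** Graphs are finite and simple. A graph property $\Pi$ is an isomorphism-closed class of graphs; a graph is $\Pi$-free if none of its induced subgraphs is isomorphic to a member of $\Pi$. In *$\Pi$-free Deletion [VC]* one is given a graph $G$ on $n$ labelled vertices, a vertex cover $X$ of $G$ with $|X|=K$, and an integer $\ell\ge 0$, and has to decide whether one can delete at most $\ell$ vertices of $G$ so that the remaining induced subgraph is $\Pi$-free. The set $X$ and $\ell$ are offline input; $G$ is read as an adjacency list (AL) stream: the vertices come in an arbitrary order, each followed by all its incident edges in arbitrary order. A streaming algorithm is deterministic, makes several passes over the same stream, and may compute without bound between two stream items; it uses $b$ bits of memory on a class of inputs if on these inputs it is only ever in at most $2^b$ different memory states. An oracle algorithm $A_1$ for $\Pi$ is a streaming algorithm which, for every $h\le\nu$ and every graph $H$ on $h$ labelled vertices given as an AL stream, decides whether $H\in\Pi$ with at most $P(h)$ passes and with $M(h)$ bits of memory. **Algorithm (branching on twin classes).** First replace $\ell$ by $\min(\ell,K)$. Enumerate in dictionary order the sets $S\subseteq X$ with $|S|\le \ell$ and put $Y=X\setminus S$. For each $S$: 1. Call $A_1$ on $G[J]$ for the sets $J\subseteq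 Y$ with $|J|\le\nu$, in dictionary order. If one of them is in $\Pi$, go to the next $S$. 2. In one pass compute, for each $k\subseteq Y$, the size $EC(k)$ of the twin class of $k$, that is, of the set of vertices $v\in V(G)\setminus X$ with $N(v)\cap Y=k$. Then call $\mathrm{Search}(S,EC)$. Answer YES if it answers YES, and go to the next $S$ otherwise. If no $S$ is left, answer NO. $\mathrm{Search}(S',EC)$: enumerate in dictionary order all $J\subseteq Y$ with $|J|\le \nu$ and, for each, all multisets $I$ of at most $\nu-|J|$ twin classes in which each class $k$ has multiplicity $c_k\le EC(k)$. For each $(J,I)$, use a pass to find for every class $k$ the first $c_k$ vertices of the class in the stream that are not in $S'$, and call $A_1$ on the subgraph of $G$ induced by these vertices and $J$, by passing on the corresponding part of the stream in each pass of $A_1$. If this subgraph is not in $\Pi$, go to the next $(J,I)$. If it is in $\Pi$: answer NO if $|S'|\ge\ell$; otherwise, for each class $k$ in $I$ in turn with $|S'|+EC(k)-(c_k-1)\le\ell$, use a pass to find a set $VS$ of $EC(k)-(c_k-1)$ vertices of class $k$ that are not in $S'$, and call $\mathrm{Search}(S'\cup VS,EC')$, where $EC'$ is $EC$ with the value at $k$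 changed to $c_k-1$; answer YES if one of these calls answers YES, and NO if none does. If no $(J,I)$ is left, answer YES. On return from a recursive call, $(J,I)$ is found again by repeating the enumeration instead of being stored. **Theorem.** There is an absolute constant $C$ such that the following holds. Let $\nu\ge1$, let $\Pi$ be a graph property all of whose members have at most $\nu$ vertices, and let $A_1$ be an oracle algorithm for $\Pi$ with pass and memory bounds $P,M:\mathbb N\to\mathbb N$ such that $P(h)\le P(\nu)$ and $M(h)\le M(\nu)$ for all $h\le\nu$. Then for all $n\ge2$ and $K\ge 0$, on all graphs $G$ on $n$ vertices, given as an AL stream, with a given vertex cover of size $K$, and on all $\ell$, the algorithm above halts after at most $$C\cdot 3^K\,\nu^{K+1}\,2^{\nu K}\,\bigl[1+P(\nu)\bigr]$$ passes, and it uses at most $$C\cdot\bigl(2^K(K+\log_2 n)+\nu\log_2 n+M(\nu)\bigr)$$ bits of memory. If $\ell\le K$ or every graph in $\Pi$ has at least one edge, then its answer is YES if and only if $G$ has a set of at most $\ell$ vertices whose deletion makes it $\Pi$-free; that is, it solves $\Pi$-free Deletion [VC]. -/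

import Mathlib

/-! ### Graph properties and the deletion problem -/

/-- A graph property: an isomorphism-invariant family of finite graphs
(every finite graph is isomorphic to one on some `Fin h`). -/
structure GraphProperty where
  Mem : ∀ {h : ℕ}, SimpleGraph (Fin h) → Prop
  mem_of_iso : ∀ {h h' : ℕ} (H : SimpleGraph (Fin h)) (H' : SimpleGraph (Fin h')),
    Nonempty (H ≃g H') → Mem H → Mem H'

/-- `G` is `Q`-free: no graph of `Q` is isomorphic to an induced subgraph of `G`. -/
def GraphProperty.Free (Q : GraphProperty) {V : Type} (G : SimpleGraph V) : Prop :=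
  ∀ (h : ℕ) (H : SimpleGraph (Fin h)), Q.Mem H → ¬ H.IsIndContained G

/-- `(G, ℓ)` is a yes-instance of `Q`-free Deletion: at most `ℓ` vertices can be deleted from `G`
so that the remaining induced subgraph is `Q`-free. -/
def GraphProperty.Deletable (Q : GraphProperty) {V : Type} (G : SimpleGraph V) (ℓ : ℕ) : Prop :=
  ∃ D : Finset V, D.card ≤ ℓ ∧ Q.Free (G.induce ((D : Set V)ᶜ))

/-! ### Adjacency list streams -/

/-- The items of an adjacency list stream. -/
inductive ALToken (V : Type) where
  /-- the adjacency list of `v` begins -/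
  | vertex (v : V)
  /-- the edge `vu`, as an entry of the adjacency list of `v` -/
  | edge (v u : V)

/-- `L` is an AL stream of `G`: the vertices arrive in an arbitrary order, each followed by all
its incident edges, in an arbitrary order. -/
def IsALStream {V : Type} (G : SimpleGraph V) (L : List (ALToken V)) : Prop :=
  ∃ (order : List V) (nbrs : V → List V),
    order.Nodup ∧ (∀ v, v ∈ order) ∧
    (∀ v, (nbrs v).Nodup ∧ ∀ u, u ∈ nbrs v ↔ G.Adj v u) ∧
    L = order.flatMap fun v => ALToken.vertex v :: (nbrs v).map (ALToken.edge v)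

/-! ### Multi-pass streaming algorithms, with passes and memory -/

/-- A deterministic multi-pass streaming algorithm with offline input in `ι` and stream items in
`τ`. Everything the algorithm remembers from one stream item to the next is its `State`; the
computation on a state is unbounded. Before the first pass and after each pass, `next` either
halts with an answer or sets the state with which the next pass begins. -/
structure StreamAlg (ι τ : Type) where
  State : Type
  init : ι → State
  next : State → State ⊕ Bool
  step : State → τ → State

namespace StreamAlg

variable {ι τ : Type}

/-- `A.Run L s p b`: from the state `s` between two passes, `A` makes exactly `p` further passes
over the stream `L` and then halts with the answer `b`. -/
inductive Run (A : StreamAlg ι τ) (L : List τ) : A.State → ℕ → Bool → Prop where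
  | halt {s : A.State} {b : Bool} : A.next s = Sum.inr b → Run A L s 0 b
  | pass {s s' : A.State} {p : ℕ} {b : Bool} : A.next s = Sum.inl s' →
      Run A L (L.foldl A.step s') p b → Run A L s (p + 1) b

/-- `A.Visits i L s r`: on the input `i` and the stream `L`, at some moment the state of `A` is `s`
and the part `r` of the stream is still to be read in the current pass. -/
inductive Visits (A : StreamAlg ι τ) (i : ι) (L : List τ) : A.State → List τ → Prop where
  | init : Visits A i L (A.init i) []
  | next {s s' : A.State} : Visits A i L s [] → A.next s = Sum.inl s' → Visits A i L s' L
  | step {s : A.State} {t : τ} {r : List τ} : Visits A i L s (t :: r) →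
      Visits A i L (A.step s t) r

/-- On the inputs and streams in `D`, the algorithm is only ever in at most `2 ^ b` different
states, that is, `b` bits of memory suffice to hold its state. -/
def UsesBits (A : StreamAlg ι τ) (D : Set (ι × List τ)) (b : ℕ) : Prop :=
  {s : A.State | ∃ x ∈ D, ∃ r, A.Visits x.1 x.2 s r}.encard ≤ 2 ^ b

end StreamAlg

/-- A streaming algorithm for graphs with `h` labelled vertices, for each `h`, without any other
input than the stream. -/
abbrev GraphOracle : Type 1 := ∀ h : ℕ, StreamAlg Unit (ALToken (Fin h))

/-- On the AL streams of the graphs `H` on `h` vertices, `A` decides whether `H` is in `Q`, with at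
most `p` passes and with `m` bits of memory. -/
def GraphOracle.Decides (A : GraphOracle) (Q : GraphProperty) (h p m : ℕ) : Prop :=
  (∀ (H : SimpleGraph (Fin h)) (L : List (ALToken (Fin h))), IsALStream H L →
    ∃ (q : ℕ) (b : Bool), (A h).Run L ((A h).init ()) q b ∧ q ≤ p ∧ (b = true ↔ Q.Mem H)) ∧
  (A h).UsesBits {x | ∃ H : SimpleGraph (Fin h), IsALStream H x.2} m

/-! ### Dictionary orderings -/

/-- All ways to pick at most `k` elements out of the pairs `(element, multiplicity)` of a list,
in dictionary order; an element is repeated as often as it is picked. -/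
def dictPicks {κ : Type} : ℕ → List (κ × ℕ) → List (List κ)
  | 0, _ => [[]]
  | k + 1, ec => [] :: ec.tails.flatMap fun t =>
      match t with
      | (a, m + 1) :: rest => (dictPicks k ((a, m) :: rest)).map fun I => a :: I
      | _ => []

/-- All subsets of at most `k` elements of `U`, in dictionary order. -/
def dictSubsets {κ : Type} (k : ℕ) (U : List κ) : List (List κ) :=
  dictPicks k (U.map fun u => (u, 1))

/-- The entry after `a` in an ordering `L`; `none` after the last one. -/
def dictNext {κ : Type} [DecidableEq κ] (L : List κ) (a : κ) : Option κ :=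
  L[L.idxOf a + 1]?

/-! ### The algorithm: branching on twin classes -/

namespace TwinBranching

/-- The name of a twin class: the common neighbourhood in `Y`, listed in the order of `Y`. -/
abbrev Key (n : ℕ) : Type := List (Fin n)

/-- The memory of a pass that treats the vertices one by one, together with their adjacencies
to `Y`: the result `acc` for the vertices before, the vertex that is being read, and its
neighbours in `Y` so far. -/
structure Reader (n : ℕ) (β : Type) where
  acc : β
  cur : Option (Fin n × Finset (Fin n))

namespace Reader

variable {n : ℕ} {β : Type}

/-- Close the current adjacency list: update the result by `f`, which is told the vertex and its
neighbourhood in `Y`. -/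
def flush (Y : List (Fin n)) (f : β → Fin n → Key n → β) (r : Reader n β) : β :=
  match r.cur with
  | none => r.acc
  | some (v, N) => f r.acc v (Y.filter fun y => y ∈ N)

def step (Y : List (Fin n)) (f : β → Fin n → Key n → β) (r : Reader n β) :
    ALToken (Fin n) → Reader n β
  | .vertex v => ⟨r.flush Y f, some (v, ∅)⟩
  | .edge _ u => ⟨r.acc, r.cur.map fun c => (c.1, if u ∈ Y then insert u c.2 else c.2)⟩

end Reader

/-- A vertex outside `X` is counted in its twin class. -/
def countVertex {n : ℕ} (X : List (Fin n)) (EC : Key n → ℕ) (v : Fin n) (k : Key n) : Key n → ℕ :=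
  if v ∈ X then EC else Function.update EC k (EC k + 1)

/-- `d.1` lists the twin classes of which a vertex is still wanted, `d.2` collects vertices.
A vertex outside `Z` is collected if its class is wanted. -/
def collectVertex {n : ℕ} (Z : List (Fin n)) (d : List (Key n) × List (Fin n)) (v : Fin n)
    (k : Key n) : List (Key n) × List (Fin n) :=
  if v ∉ Z ∧ k ∈ d.1 then (d.1.erase k, v :: d.2) else d

/-- The item of the stream of `G[W]` that an item of the stream of `G` gives rise to, if any;
the vertices of `W` are renamed to their positions in `W`. -/
def restrictToken {n : ℕ} (W : List (Fin n)) : ALToken (Fin n) → Option (ALToken (Fin W.length))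
  | .vertex v => if hv : v ∈ W then some (.vertex ⟨W.idxOf v, List.idxOf_lt_length_of_mem hv⟩)
      else none
  | .edge v u => if h : v ∈ W ∧ u ∈ W then
      some (.edge ⟨W.idxOf v, List.idxOf_lt_length_of_mem h.1⟩
        ⟨W.idxOf u, List.idxOf_lt_length_of_mem h.2⟩)
      else none

/-- A node of the search tree: the current sizes of the twin classes; the branchings that lead to
the node, latest first, each with the class that was cut down and the vertices that were deleted;
and, after return from a child of the node, the class of that child. -/
structure Node (n : ℕ) where
  EC : Key n → ℕ
  stack : List (Key n × List (Fin n))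
  resume : Option (Key n)

/-- The vertices outside the vertex cover that are deleted at a node. -/
def Node.deleted {n : ℕ} (N : Node n) : List (Fin n) := N.stack.flatMap Prod.snd

/-- What an oracle call is made for: the test whether a subset `J` of `Y` induces a graph in the
property, or the search at a node for `J ⊆ Y` and vertices of the classes in `I` that do. -/
inductive Task (n : ℕ) where
  | check (J : List (Fin n))
  | search (N : Node n) (J : List (Fin n)) (I : List (Key n))

/-- The phases of the algorithm. All but `start` last for one pass or, for `ask`, for the passes
of the oracle. -/
inductive Phase (A : GraphOracle) (n : ℕ) where
  | start
  /-- determine the sizes of the twin classes -/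
  | count (r : Reader n (Key n → ℕ))
  /-- find the vertices to be passed to the oracle -/
  | pick (T : Task n) (r : Reader n (List (Key n) × List (Fin n)))
  /-- run the oracle on the subgraph induced by `W` -/
  | ask (T : Task n) (W : List (Fin n)) (s : (A W.length).State)
  /-- find vertices of class `k` to be deleted -/
  | delete (N : Node n) (k : Key n) (r : Reader n (List (Key n) × List (Fin n)))

/-- The memory of the algorithm: vertex cover, budget, part of the vertex cover that is deleted,
and phase. -/
structure Mem (A : GraphOracle) (n : ℕ) where
  X : List (Fin n)
  budget : ℕ
  S : List (Fin n)
  phase : Phase A n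

namespace Mem

variable {A : GraphOracle} {n : ℕ}

/-- The part of the vertex cover that must not be deleted. -/
def Y (m : Mem A n) : List (Fin n) := m.X.filter fun x => x ∉ m.S

/-- The vertices that must not be collected for the classes at a task: the vertex cover and the deleted
vertices. -/
def unavailable (m : Mem A n) : Task n → List (Fin n)
  | .check _ => m.X
  | .search N _ _ => m.X ++ N.deleted

/-- All twin classes with their current sizes. -/
def classes (m : Mem A n) (EC : Key n → ℕ) : List (Key n × ℕ) :=
  (dictSubsets m.Y.length m.Y).map fun k => (k, EC k)

/-- Start an oracle call, by a pass which finds a vertex for each class in `I`. -/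
def query (m : Mem A n) (T : Task n) : Mem A n :=
  { m with phase := .pick T ⟨match T with
      | .check J => ([], J)
      | .search _ J I => (I, J), none⟩ }

/-- Continue with the next deleted part of the vertex cover; answer NO if there is none. -/
def nextCover (m : Mem A n) : Mem A n ⊕ Bool :=
  match dictNext (dictSubsets m.budget m.X) m.S with
  | some S' => .inl (({ m with S := S' } : Mem A n).query (.check []))
  | none => .inr false

/-- The search at the node `N` has answered NO: return to its parent, or to the loop over the
deleted parts of the vertex cover. -/
def fail (m : Mem A n) (N : Node n) : Mem A n ⊕ Bool :=
  match N.stack with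
  | [] => m.nextCover
  | (k, VS) :: st => .inl (m.query
      (.search ⟨Function.update N.EC k (N.EC k + VS.length), st, some k⟩ [] []))

/-- At the node `N`, the classes in `I`, together with some part of `Y`, induce a graph in the
property: branch on the next class `k` of `I` that the budget permits to cut down to
`I.count k - 1` vertices. -/
def branch (m : Mem A n) (N : Node n) (I : List (Key n)) : Mem A n ⊕ Bool :=
  let size := m.S.length + N.deleted.length
  if m.budget ≤ size then m.fail N
  else
    let todo := match N.resume with
      | none => I.dedup
      | some k => I.dedup.drop (I.dedup.idxOf k + 1)
    match todo.find? fun k => size + (N.EC k - (I.count k - 1)) ≤ m.budget with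
    | none => m.fail N
    | some k => .inl { m with
        phase := .delete N k ⟨(List.replicate (N.EC k - (I.count k - 1)) k, []), none⟩ }

/-- Continue after the answer `b` of the oracle. -/
def answer (ν : ℕ) (m : Mem A n) : Task n → Bool → Mem A n ⊕ Bool
  | .check _, true => m.nextCover
  | .check J, false =>
      match dictNext (dictSubsets ν m.Y) J with
      | some J' => .inl (m.query (.check J'))
      | none => .inl { m with phase := .count ⟨fun _ => 0, none⟩ }
  | .search N _ I, true => m.branch N I
  | .search N J I, false =>
      match dictNext (dictPicks (ν - J.length) (m.classes N.EC)) I with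
      | some I' => .inl (m.query (.search N J I'))
      | none =>
          match dictNext (dictSubsets ν m.Y) J with
          | some J' => .inl (m.query (.search N J' []))
          | none => .inr true

/-- Let the oracle, in state `s` between two passes, continue on the subgraph induced by `W`. -/
def consult (ν : ℕ) (m : Mem A n) (T : Task n) (W : List (Fin n)) (s : (A W.length).State) :
    Mem A n ⊕ Bool :=
  match (A W.length).next s with
  | .inl s' => .inl { m with phase := .ask T W s' }
  | .inr b => m.answer ν T b

/-- The transition between two passes. -/
def next (ν : ℕ) (m : Mem A n) : Mem A n ⊕ Bool :=
  match m.phase with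
  | .start => .inl (({ m with S := [] } : Mem A n).query (.check []))
  | .count r => .inl (m.query (.search ⟨r.flush m.Y (countVertex m.X), [], none⟩ [] []))
  | .pick T r =>
      m.consult ν T (r.flush m.Y (collectVertex (m.unavailable T))).2 ((A _).init ())
  | .ask T W s => m.consult ν T W s
  | .delete N k r =>
      let VS := (r.flush m.Y (collectVertex (m.X ++ N.deleted))).2
      .inl (m.query
        (.search ⟨Function.update N.EC k (N.EC k - VS.length), (k, VS) :: N.stack, none⟩ [] []))

/-- The treatment of one item of the stream. -/
def step (m : Mem A n) (t : ALToken (Fin n)) : Mem A n :=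
  match m.phase with
  | .start => m
  | .count r => { m with phase := .count (r.step m.Y (countVertex m.X) t) }
  | .pick T r =>
      { m with phase := .pick T (r.step m.Y (collectVertex (m.unavailable T)) t) }
  | .ask T W s =>
      match restrictToken W t with
      | none => m
      | some t' => { m with phase := .ask T W ((A W.length).step s t') }
  | .delete N k r =>
      { m with phase := .delete N k (r.step m.Y (collectVertex (m.X ++ N.deleted)) t) }

end Mem

/-- The algorithm for graphs on `Fin n`, given a bound `ν` on the size of the graphs in the
property and an oracle `A` for the property. Its offline input is a vertex cover `X` and a
budget `ℓ`; budgets above `|X|` are replaced by `|X|`. -/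
def alg (A : GraphOracle) (ν n : ℕ) : StreamAlg (Finset (Fin n) × ℕ) (ALToken (Fin n)) where
  State := Mem A n
  init i := ⟨i.1.sort (· ≤ ·), min i.2 i.1.card, [], .start⟩
  next := Mem.next ν
  step := Mem.step

end TwinBranching

/-!
Let `Y` be the part of the vertex cover that is not deleted. Vertices outside the vertex cover are
pairwise non-adjacent, so two of them with the same neighbourhood in `Y` are twins, and whether a
set `J ⊆ Y` and some vertices outside the vertex cover induce a graph in the property depends only
on `J` and on the multiset `I` of the twin classes of these vertices (`bad_iff`). Hence a solution
is described by its part `S` in the vertex cover and the number `e k` of vertices that it leaves in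
each class `k`, and it is one exactly if no bad pair `(J, I)` fits into `e` (`free_induce_iff`,
`deletable_iff`). If a bad pair `(J, I)` fits into the current class sizes, then `e` must stay below
the multiplicity in `I` for some class of `I`, and which vertices of the class are deleted does not
matter. This is the branching rule (`solvable_iff_of_bad`), and it makes the search correct.

*Passes.* Since the class sizes stored at a node are the true ones, every branching deletes at least
one vertex. So a node with `d` deletions left has at most `ν` children, each with fewer deletions
left. The pairs `(J, I)` are enumerated once at the start of a node and once more after each child;
the repeated enumeration stops at the same pair because that pair depends on the class sizes only
(`scan_go`). With `y = |Y|` there are at most `4 ν 2 ^ (ν y)` pairs (`sum_length_dictPicks_le`), and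
induction on `d` bounds the search by `(2 ν) ^ d` times three enumerations (`search_go`). As
`d ≤ y = K - |S|`, the sum over `S` is binomial, and `2 ν 2 ^ ν + 1 ≤ 3 ν 2 ^ ν` gives the factor
`3 ^ K` (`sum_cover_cost_le`).

*Memory.* An invariant describes the states with which a pass can begin (`MemGood`, `next_good`),
and every visited state arises from one of these by a part of a pass (`exists_good_of_visits`). The
visited states are then covered by a set that is encoded with few bits, field by field
(`fitsIn_memSet`). The class sizes take `2 ^ K log n` bits, and so does a multiset of classes: as it
is listed in dictionary order, its multiplicities determine it. The stack takes `O(K² log n)` bits,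
the vertices collected for the oracle `O(ν log n)`, and the oracle itself `M ν`.
-/

/-! ### Dictionary orderings -/

section Dictionary

variable {κ : Type}

theorem cons_sublist_replicate_append {a b : κ} {I t : List κ} {m : ℕ} :
    (a :: I).Sublist (List.replicate m b ++ t) ↔
      (∃ c, m = c + 1 ∧ a = b ∧ I.Sublist (List.replicate c b ++ t)) ∨ (a :: I).Sublist t := by
  induction m with
  | zero => simp
  | succ m ih =>
    rw [List.replicate_succ, List.cons_append, List.cons_sublist_cons']
    constructor
    · rintro (h | ⟨rfl, h⟩)
      · rcases ih.1 h with ⟨c, rfl, rfl, h'⟩ | h'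
        · exact Or.inl ⟨c + 1, rfl, rfl, (List.sublist_cons_self _ _).trans h⟩
        · exact Or.inr h'
      · exact Or.inl ⟨m, rfl, rfl, h⟩
    · rintro (⟨c, hc, rfl, h⟩ | h)
      · obtain rfl : m = c := by omega
        exact Or.inr ⟨rfl, h⟩
      · exact Or.inl (h.trans (List.sublist_append_right _ _))

theorem cons_sublist_flatMap_replicate {a : κ} {I : List κ} {ec : List (κ × ℕ)} :
    (a :: I).Sublist (ec.flatMap fun p => List.replicate p.2 p.1) ↔
      ∃ m rest, (a, m + 1) :: rest ∈ ec.tails ∧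
        I.Sublist (((a, m) :: rest).flatMap fun p => List.replicate p.2 p.1) := by
  induction ec with
  | nil => simp
  | cons p ec ih =>
    obtain ⟨b, c⟩ := p
    rw [List.flatMap_cons, cons_sublist_replicate_append, ih]
    simp only [List.tails, List.mem_cons]
    constructor
    · rintro (⟨d, hd, rfl, h⟩ | ⟨m, rest, h, h'⟩)
      · exact ⟨d, ec, Or.inl (by simp [← hd]), h⟩
      · exact ⟨m, rest, Or.inr h, h'⟩
    · rintro ⟨m, rest, (h | h), h'⟩
      · simp only [List.cons.injEq, Prod.mk.injEq] at h
        obtain ⟨⟨rfl, rfl⟩, rfl⟩ := h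
        exact Or.inl ⟨m, rfl, rfl, h'⟩
      · exact Or.inr ⟨m, rest, h, h'⟩

theorem cons_mem_dictPicks_succ {a : κ} {I : List κ} {k : ℕ} {ec : List (κ × ℕ)} :
    a :: I ∈ dictPicks (k + 1) ec ↔
      ∃ m rest, (a, m + 1) :: rest ∈ ec.tails ∧ I ∈ dictPicks k ((a, m) :: rest) := by
  simp only [dictPicks, List.mem_cons, reduceCtorEq, false_or, List.mem_flatMap]
  constructor
  · rintro ⟨t, ht, h⟩
    split at h
    · simp only [List.mem_map, List.cons.injEq] at h
      obtain ⟨I', h', rfl, rfl⟩ := h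
      exact ⟨_, _, ht, h'⟩
    · simp at h
  · rintro ⟨m, rest, ht, h⟩
    exact ⟨_, ht, by simpa using h⟩

/-- The picks are the short sublists of the list in which every element is repeated according to
its multiplicity. -/
theorem mem_dictPicks {k : ℕ} {ec : List (κ × ℕ)} {I : List κ} :
    I ∈ dictPicks k ec ↔
      I.length ≤ k ∧ I.Sublist (ec.flatMap fun p => List.replicate p.2 p.1) := by
  induction k generalizing I ec with
  | zero =>
    simp only [dictPicks, List.mem_singleton, Nat.le_zero, List.length_eq_zero_iff]
    exact ⟨fun h => ⟨h, h ▸ List.nil_sublist _⟩, fun h => h.1⟩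
  | succ k ih =>
    cases I with
    | nil => simp [dictPicks]
    | cons a I =>
      rw [cons_mem_dictPicks_succ, cons_sublist_flatMap_replicate]
      simp only [ih, List.length_cons, Nat.add_le_add_iff_right]
      exact ⟨fun ⟨m, rest, h, h1, h2⟩ => ⟨h1, m, rest, h, h2⟩,
        fun ⟨h1, m, rest, h, h2⟩ => ⟨m, rest, h, h1, h2⟩⟩

theorem mem_dictSubsets {k : ℕ} {U J : List κ} :
    J ∈ dictSubsets k U ↔ J.length ≤ k ∧ J.Sublist U := by
  rw [dictSubsets, mem_dictPicks, List.flatMap_map]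
  simp

theorem dictPicks_eq_cons (k : ℕ) (ec : List (κ × ℕ)) : ∃ t, dictPicks k ec = [] :: t := by
  cases k with
  | zero => exact ⟨[], rfl⟩
  | succ k => exact ⟨_, rfl⟩

theorem nodup_dictPicks {k : ℕ} {ec : List (κ × ℕ)} (h : (ec.map Prod.fst).Nodup) :
    (dictPicks k ec).Nodup := by
  induction k generalizing ec with
  | zero => simp [dictPicks]
  | succ k ih =>
    rw [dictPicks, List.nodup_cons]
    constructor
    · rw [List.mem_flatMap]
      rintro ⟨t, -, ht⟩
      split at ht <;> simp at ht
    · induction ec with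
      | nil => simp [List.tails]
      | cons p ec ihe =>
        rw [List.map_cons, List.nodup_cons] at h
        rw [List.tails, List.flatMap_cons, List.nodup_append']
        refine ⟨?_, ihe h.2, ?_⟩
        · obtain ⟨a, m⟩ := p
          cases m with
          | zero => simp
          | succ m =>
            exact (ih (by simpa using h)).map (fun _ _ e => (List.cons.inj e).2)
        · -- the picks of a tail begin with the first element of that tail
          intro I h1 h2
          obtain ⟨a, m⟩ := p
          cases m with
          | zero => simp at h1
          | succ m =>
            simp only [List.mem_map] at h1
            obtain ⟨I, -, rfl⟩ := h1
            rw [List.mem_flatMap] at h2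
            obtain ⟨t, ht, h2⟩ := h2
            split at h2
            · simp only [List.mem_map, List.cons.injEq] at h2
              obtain ⟨_, -, rfl, -⟩ := h2
              exact h.1 (List.mem_map.2
                ⟨_, ((List.mem_tails _ _).1 ht).subset List.mem_cons_self, rfl⟩)
            · simp at h2

theorem nodup_dictSubsets {k : ℕ} {U : List κ} (h : U.Nodup) : (dictSubsets k U).Nodup :=
  nodup_dictPicks (by simpa [Function.comp_def] using h)

/-- A bound on the number of picks, weighted by the number of elements that could still be picked,
from a recursive inequality: a nonempty pick is one of at most `N` first elements followed by a
shorter pick. -/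
theorem sum_dictPicks_le {g R : ℕ → ℕ} {N : ℕ} (h0 : g 0 ≤ R 0)
    (hs : ∀ k, g (k + 1) + N * R k ≤ R (k + 1)) (k : ℕ) (ec : List (κ × ℕ))
    (hec : ec.length ≤ N) : ((dictPicks k ec).map fun I => g (k - I.length)).sum ≤ R k := by
  induction k generalizing ec with
  | zero => simpa [dictPicks] using h0
  | succ k ih =>
    refine le_trans ?_ (hs k)
    rw [dictPicks, List.map_cons, List.sum_cons]
    refine Nat.add_le_add (by simp) ?_
    have key : ∀ ec : List (κ × ℕ), ec.length ≤ N →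
        ((ec.tails.flatMap fun t => match t with
          | (a, m + 1) :: rest => (dictPicks k ((a, m) :: rest)).map fun I => a :: I
          | _ => []).map fun I => g (k + 1 - I.length)).sum ≤ ec.length * R k := by
      intro ec hec
      induction ec with
      | nil => simp [List.tails]
      | cons p ec ihe =>
        rw [List.tails, List.flatMap_cons, List.map_append, List.sum_append, List.length_cons,
          Nat.add_mul, Nat.one_mul, Nat.add_comm]
        refine Nat.add_le_add (ihe (by simp at hec; omega)) ?_
        obtain ⟨a, m⟩ := p
        cases m with
        | zero => simp
        | succ m =>
          have := ih ((a, m) :: ec) (by simpa using hec)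
          simpa [Function.comp_def] using this
    exact (key ec hec).trans (Nat.mul_le_mul_right _ hec)

/-- In an ordering without repetitions, `dictNext` is the successor; with repetitions it would
jump back. -/
theorem dictNext_append [DecidableEq κ] {pre post : List κ} {a : κ}
    (h : (pre ++ a :: post).Nodup) : dictNext (pre ++ a :: post) a = post.head? := by
  have ha : a ∉ pre := fun ha => by
    rw [List.nodup_append'] at h
    exact h.2.2 ha (by simp)
  rw [dictNext, List.idxOf_append_of_notMem ha, List.idxOf_cons_self]
  cases post <;> simp

theorem mem_of_dictNext [DecidableEq κ] {L : List κ} {a b : κ} (h : dictNext L a = some b) :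
    b ∈ L := List.mem_of_getElem? h

end Dictionary

/-! ### Sequences of passes -/


/-- `Passes next step L x p y`: when the transition `next` between two passes has the outcome `x`,
then `p` passes over `L` later it has the outcome `y`. -/
inductive Passes {σ τ : Type} (next : σ → σ ⊕ Bool) (step : σ → τ → σ) (L : List τ) :
    σ ⊕ Bool → ℕ → σ ⊕ Bool → Prop where
  | refl (x : σ ⊕ Bool) : Passes next step L x 0 x
  | pass {s : σ} {p : ℕ} {y : σ ⊕ Bool} :
      Passes next step L (next (L.foldl step s)) p y → Passes next step L (Sum.inl s) (p + 1) y

namespace Passes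

variable {σ τ : Type} {next : σ → σ ⊕ Bool} {step : σ → τ → σ} {L : List τ}

theorem trans {x y z : σ ⊕ Bool} {p q : ℕ} (h : Passes next step L x p y)
    (h' : Passes next step L y q z) : Passes next step L x (p + q) z := by
  induction h with
  | refl => simpa using h'
  | pass _ ih => rw [Nat.add_right_comm]; exact .pass (ih h')

theorem run {ι : Type} {A : StreamAlg ι τ} {x : A.State ⊕ Bool} {p : ℕ} {b : Bool}
    (h : Passes A.next A.step L x p (Sum.inr b)) {s : A.State} (hs : A.next s = x) : A.Run L s p b := by
  generalize hy : (Sum.inr b : A.State ⊕ Bool) = y at h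
  induction h generalizing s with
  | refl => exact .halt (hs.trans hy.symm)
  | pass _ ih => exact .pass hs (ih rfl hy)

/-- A loop over the entries of a dictionary ordering: from the entry `a` the computation proceeds
to `g a` if `a` is a hit, and to the next entry otherwise; after the last entry it proceeds
to `e`. So it arrives at the outcome for the first hit. -/
theorem exists_passes_find {κ : Type} [DecidableEq κ] {D : List κ} (hD : D.Nodup)
    {f g : κ → σ ⊕ Bool} {e : σ ⊕ Bool} {hit : κ → Bool} {c : κ → ℕ}
    (hstep : ∀ a ∈ D, ∃ q ≤ c a, Passes next step L (f a) q
      (if hit a then g a else (dictNext D a).elim e f))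
    {a₀ : κ} (h0 : D.head? = some a₀) :
    ∃ q ≤ (D.map c).sum, Passes next step L (f a₀) q ((D.find? hit).elim e g) := by
  have key : ∀ (post pre : List κ) (a : κ), D = pre ++ a :: post →
      ∃ q ≤ ((a :: post).map c).sum, Passes next step L (f a) q (((a :: post).find? hit).elim e g) := by
    intro post
    induction post with
    | nil =>
      intro pre a ha
      obtain ⟨q, hq, h⟩ := hstep a (by simp [ha])
      have hn : dictNext D a = none := by
        rw [ha] at hD ⊢
        exact dictNext_append hD
      refine ⟨q, by simpa using hq, ?_⟩
      by_cases hb : hit a = true <;> simpa [hb, hn] using h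
    | cons b post ih =>
      intro pre a ha
      obtain ⟨q, hq, h⟩ := hstep a (by simp [ha])
      by_cases hb : hit a = true
      · exact ⟨q, by simp only [List.map_cons, List.sum_cons]; omega, by simpa [hb] using h⟩
      · have hn : dictNext D a = some b := by
          rw [ha] at hD ⊢
          exact dictNext_append hD
        obtain ⟨q', hq', h'⟩ := ih (pre ++ [a]) b (by simp [ha])
        refine ⟨q + q', by rw [List.map_cons, List.sum_cons]; exact Nat.add_le_add hq hq', ?_⟩
        rw [List.find?_cons_of_neg (by simpa using hb)]
        exact Passes.trans (by simpa [hb, hn] using h) h'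
  cases hD' : D with
  | nil => simp [hD'] at h0
  | cons a post =>
    rw [hD'] at h0
    obtain rfl : a = a₀ := by simpa using h0
    exact key post [] a hD'

end Passes

/-! ### What a pass computes -/

namespace TwinBranching

variable {n : ℕ}

open Classical in
/-- The name of the twin class of `v`: the neighbours of `v` in `Y`, in the order of `Y`. -/
noncomputable def classOf (G : SimpleGraph (Fin n)) (Y : List (Fin n)) (v : Fin n) : Key n :=
  Y.filter fun y => G.Adj v y

theorem mem_classOf {G : SimpleGraph (Fin n)} {Y : List (Fin n)} {v u : Fin n} :
    u ∈ classOf G Y v ↔ u ∈ Y ∧ G.Adj v u := by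
  simp [classOf]

theorem classOf_sublist (G : SimpleGraph (Fin n)) (Y : List (Fin n)) (v : Fin n) :
    (classOf G Y v).Sublist Y := List.filter_sublist

/-- The number of adjacency lists that begin in a part of a stream. -/
def numLists {V : Type} (l : List (ALToken V)) : ℕ :=
  l.countP fun t => match t with
    | .vertex _ => true
    | .edge _ _ => false

namespace Reader

variable {β : Type} {Y : List (Fin n)} {f : β → Fin n → Key n → β}

theorem foldl_edges (Y : List (Fin n)) (f : β → Fin n → Key n → β) (v w : Fin n)
    (us : List (Fin n)) (a : β) (N : Finset (Fin n)) :
    ∃ N' : Finset (Fin n), (∀ u, u ∈ N' ↔ u ∈ N ∨ (u ∈ us ∧ u ∈ Y)) ∧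
      (us.map (ALToken.edge v)).foldl (Reader.step Y f) ⟨a, some (w, N)⟩ = ⟨a, some (w, N')⟩ := by
  induction us generalizing N with
  | nil => exact ⟨N, by simp, rfl⟩
  | cons u us ih =>
    obtain ⟨N', h, h'⟩ := ih (if u ∈ Y then insert u N else N)
    refine ⟨N', fun x => ?_, h'⟩
    rw [h]
    split
    · simp only [Finset.mem_insert, List.mem_cons]
      grind
    · simp only [List.mem_cons]
      grind

theorem flush_foldl_block {G : SimpleGraph (Fin n)} {v : Fin n} {us : List (Fin n)}
    (hus : ∀ u, u ∈ us ↔ G.Adj v u) (r : Reader n β) :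
    ((ALToken.vertex v :: us.map (ALToken.edge v)).foldl (Reader.step Y f) r).flush Y f =
      f (r.flush Y f) v (classOf G Y v) := by
  obtain ⟨N, hN, h⟩ := foldl_edges Y f v v us (r.flush Y f) ∅
  rw [List.foldl_cons]
  change ((us.map (ALToken.edge v)).foldl (Reader.step Y f) ⟨r.flush Y f, some (v, ∅)⟩).flush Y f = _
  rw [h]
  change f (r.flush Y f) v _ = _
  congr 1
  refine List.filter_congr fun u hu => ?_
  simp [hN, hus, hu]

/-- After a pass, the result is as if the vertices came one by one with their twin classes. -/
theorem flush_foldl {G : SimpleGraph (Fin n)} {nbrs : Fin n → List (Fin n)}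
    (h : ∀ v u, u ∈ nbrs v ↔ G.Adj v u) (order : List (Fin n)) (r : Reader n β) :
    ((order.flatMap fun v => ALToken.vertex v :: (nbrs v).map (ALToken.edge v)).foldl
      (Reader.step Y f) r).flush Y f =
      order.foldl (fun a v => f a v (classOf G Y v)) (r.flush Y f) := by
  induction order generalizing r with
  | nil => rfl
  | cons v order ih =>
    rw [List.flatMap_cons, List.foldl_append, ih, flush_foldl_block (h v), List.foldl_cons]

/-- An invariant of a pass which is indexed by the number of vertices that have been treated. -/
theorem foldl_invariant {p : ℕ → β → Prop}
    (hp : ∀ i a v (N : Finset (Fin n)), p i a → p (i + 1) (f a v (Y.filter fun y => y ∈ N)))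
    {a : β} (ha : p 0 a) (l : List (ALToken (Fin n))) :
    (∃ i ≤ numLists l, p i (l.foldl (Reader.step Y f) ⟨a, none⟩).acc) ∧
      ∀ c ∈ (l.foldl (Reader.step Y f) ⟨a, none⟩).cur, ∀ u ∈ c.2, u ∈ Y := by
  suffices h : (∃ i, i + (if (l.foldl (Reader.step Y f) ⟨a, none⟩).cur.isSome then 1 else 0) =
        numLists l ∧ p i (l.foldl (Reader.step Y f) ⟨a, none⟩).acc) ∧
      ∀ c ∈ (l.foldl (Reader.step Y f) ⟨a, none⟩).cur, ∀ u ∈ c.2, u ∈ Y by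
    obtain ⟨⟨i, hi, h1⟩, h2⟩ := h
    exact ⟨⟨i, by omega, h1⟩, h2⟩
  induction l using List.reverseRecOn with
  | nil => exact ⟨⟨0, by simp [numLists], ha⟩, by simp⟩
  | append_singleton l t ih =>
    rw [List.foldl_append, List.foldl_cons, List.foldl_nil]
    generalize l.foldl (Reader.step Y f) ⟨a, none⟩ = r at ih
    obtain ⟨b, c⟩ := r
    obtain ⟨⟨i, hi, h1⟩, h2⟩ := ih
    cases t with
    | vertex v =>
      refine ⟨?_, by simp [Reader.step]⟩
      cases c with
      | none => exact ⟨i, by simpa [numLists, Reader.step] using hi, h1⟩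
      | some c =>
        refine ⟨i + 1, by simpa [numLists, Reader.step] using hi, ?_⟩
        exact hp _ _ _ _ h1
    | edge v u =>
      refine ⟨⟨i, by simpa [numLists, Reader.step] using hi, h1⟩, ?_⟩
      cases c with
      | none => simp [Reader.step]
      | some c =>
        simp only [Reader.step, Option.map_some, Option.mem_some_iff, forall_eq'] at h2 ⊢
        intro w hw
        split at hw
        · rcases Finset.mem_insert.1 hw with rfl | hw
          · assumption
          · exact h2 _ hw
        · exact h2 _ hw

end Reader

theorem numLists_stream {V : Type} (order : List V) (nbrs : V → List V) :
    numLists (order.flatMap fun v => ALToken.vertex v :: (nbrs v).map (ALToken.edge v)) =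
      order.length := by
  induction order with
  | nil => rfl
  | cons v order ih =>
    rw [List.flatMap_cons, numLists, List.countP_append, ← numLists, ← numLists, ih]
    simp [numLists, Function.comp_def, Nat.add_comm]

theorem numLists_le_of_isALStream {G : SimpleGraph (Fin n)} {l r : List (ALToken (Fin n))}
    (h : IsALStream G (l ++ r)) : numLists l ≤ n := by
  obtain ⟨order, nbrs, hnd, -, -, hL⟩ := h
  have h1 : numLists (l ++ r) = order.length := by rw [hL, numLists_stream]
  have h2 : order.length ≤ n := by simpa using hnd.length_le_card
  rw [numLists, List.countP_append, ← numLists] at h1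
  omega

/-- The result of a pass over an AL stream, for every reader at once. -/
theorem exists_order_of_isALStream {G : SimpleGraph (Fin n)} {L : List (ALToken (Fin n))}
    (h : IsALStream G L) : ∃ order : List (Fin n), order.Nodup ∧ (∀ v, v ∈ order) ∧
      ∀ (β : Type) (Y : List (Fin n)) (f : β → Fin n → Key n → β) (a : β),
        (L.foldl (Reader.step Y f) ⟨a, none⟩).flush Y f =
          order.foldl (fun a v => f a v (classOf G Y v)) a := by
  obtain ⟨order, nbrs, hnd, hmem, hnb, rfl⟩ := h
  exact ⟨order, hnd, hmem, fun β Y f a => Reader.flush_foldl (fun v => (hnb v).2) order _⟩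

/-! ### Counting and collecting -/

theorem foldl_countVertex (X : List (Fin n)) (c : Fin n → Key n) {order : List (Fin n)}
    (h : order.Nodup) (EC : Key n → ℕ) (k : Key n) :
    order.foldl (fun a v => countVertex X a v (c v)) EC k =
      EC k + (order.toFinset.filter fun v => v ∉ X ∧ c v = k).card := by
  induction order generalizing EC with
  | nil => simp
  | cons v order ih =>
    rw [List.nodup_cons] at h
    rw [List.foldl_cons, ih h.2, List.toFinset_cons, Finset.filter_insert]
    have hv : v ∉ order.toFinset.filter fun v => v ∉ X ∧ c v = k := by simp [h.1]
    unfold countVertex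
    by_cases hX : v ∈ X
    · simp [hX]
    · by_cases hk : c v = k
      · subst hk
        rw [if_neg hX, if_pos ⟨hX, rfl⟩, Finset.card_insert_of_notMem hv]
        simp
        omega
      · rw [if_neg hX, if_neg (by simp [hk]), Function.update_of_ne (Ne.symm hk)]

/-- Collecting never takes a vertex twice, the classes found and still wanted together make up `I`,
and a class is still wanted only if all its available vertices have been taken. -/
theorem foldl_collectVertex (Z : List (Fin n)) (c : Fin n → Key n) {order : List (Fin n)}
    (h : order.Nodup) (I : List (Key n)) (J : List (Fin n)) :
    ∃ W, (order.foldl (fun d v => collectVertex Z d v (c v)) (I, J)).2 = W ++ J ∧ W.Nodup ∧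
      (∀ v ∈ W, v ∈ order ∧ v ∉ Z) ∧
      (W.map c ++ (order.foldl (fun d v => collectVertex Z d v (c v)) (I, J)).1).Perm I ∧
      ∀ v ∈ order, v ∉ Z →
        c v ∈ (order.foldl (fun d v => collectVertex Z d v (c v)) (I, J)).1 → v ∈ W := by
  induction order generalizing I J with
  | nil => exact ⟨[], by simp⟩
  | cons v order ih =>
    rw [List.nodup_cons] at h
    by_cases hv : v ∉ Z ∧ c v ∈ I
    · obtain ⟨W, h1, h2, h3, h4, h5⟩ := ih h.2 (I.erase (c v)) (v :: J)
      rw [List.foldl_cons, collectVertex, if_pos hv]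
      refine ⟨W ++ [v], by simp [h1], ?_, ?_, ?_, ?_⟩
      · rw [List.nodup_append']
        refine ⟨h2, by simp, ?_⟩
        intro x hx hx'
        obtain rfl : x = v := by simpa using hx'
        exact h.1 (h3 x hx).1
      · intro x hx
        rcases List.mem_append.1 hx with hx | hx
        · exact ⟨List.mem_cons_of_mem _ (h3 x hx).1, (h3 x hx).2⟩
        · obtain rfl : x = v := by simpa using hx
          exact ⟨List.mem_cons_self, hv.1⟩
      · refine List.Perm.trans ?_ (List.perm_cons_erase hv.2).symm
        rw [List.map_append, List.map_singleton, List.append_assoc, List.singleton_append]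
        exact List.perm_middle.trans (h4.cons _)
      · intro x hx hxZ hxc
        rcases List.mem_cons.1 hx with rfl | hx
        · simp
        · exact List.mem_append_left _ (h5 x hx hxZ hxc)
    · obtain ⟨W, h1, h2, h3, h4, h5⟩ := ih h.2 I J
      rw [List.foldl_cons, collectVertex, if_neg hv]
      refine ⟨W, h1, h2, fun x hx => ⟨List.mem_cons_of_mem _ (h3 x hx).1, (h3 x hx).2⟩, h4, ?_⟩
      intro x hx hxZ hxc
      rcases List.mem_cons.1 hx with rfl | hx
      · exact absurd ⟨hxZ, h4.subset (List.mem_append_right _ hxc)⟩ hv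
      · exact h5 x hx hxZ hxc

/-- If all classes are large enough, the wanted vertices are found. -/
theorem exists_foldl_collectVertex (Z : List (Fin n)) (c : Fin n → Key n) {order : List (Fin n)}
    (h : order.Nodup) (hmem : ∀ v, v ∈ order) {I : List (Key n)} (J : List (Fin n))
    (hI : ∀ k, I.count k ≤ (Finset.univ.filter fun v => v ∉ Z ∧ c v = k).card) :
    ∃ W, (order.foldl (fun d v => collectVertex Z d v (c v)) (I, J)).2 = W ++ J ∧ W.Nodup ∧
      (∀ v ∈ W, v ∉ Z) ∧ (W.map c).Perm I := by
  obtain ⟨W, h1, h2, h3, h4, h5⟩ := foldl_collectVertex Z c h I J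
  refine ⟨W, h1, h2, fun v hv => (h3 v hv).2, ?_⟩
  have h6 : (order.foldl (fun d v => collectVertex Z d v (c v)) (I, J)).1 = [] := by
    rw [List.eq_nil_iff_forall_not_mem]
    intro k hk
    have h7 : (Finset.univ.filter fun v => v ∉ Z ∧ c v = k) ⊆
        (W.filter fun v => c v = k).toFinset := by
      intro v hv
      simp only [Finset.mem_filter, Finset.mem_univ, true_and] at hv
      simp only [List.mem_toFinset, List.mem_filter, decide_eq_true_eq]
      exact ⟨h5 v (hmem v) hv.1 (hv.2 ▸ hk), hv.2⟩
    have h8 := (Finset.card_le_card h7).trans (List.toFinset_card_le _)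
    have h9 := h4.count_eq k
    rw [List.count_append] at h9
    have h10 : (W.filter fun v => c v = k).length = (W.map c).count k := by
      rw [List.count, List.countP_map, List.countP_eq_length_filter]
      congr 1
      refine List.filter_congr fun v _ => ?_
      rw [Function.comp_apply, Bool.eq_iff_iff, decide_eq_true_iff, beq_iff_eq]
    have h11 := List.count_pos_iff.2 hk
    have := hI k
    omega
  rwa [h6, List.append_nil] at h4

/-! ### The stream that the oracle reads -/

/-- The position of `v` in `W`, if any. -/
def position (W : List (Fin n)) (v : Fin n) : Option (Fin W.length) :=
  if h : v ∈ W then some ⟨W.idxOf v, List.idxOf_lt_length_of_mem h⟩ else none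

theorem position_eq_some {W : List (Fin n)} (hW : W.Nodup) {v : Fin n} {i : Fin W.length} :
    position W v = some i ↔ W.get i = v := by
  unfold position
  split
  · rename_i h
    rw [Option.some.injEq]
    constructor
    · rintro rfl
      simp
    · rintro rfl
      simp [hW.idxOf_getElem]
  · rename_i h
    simp only [reduceCtorEq, false_iff]
    rintro rfl
    exact h (List.get_mem _ _)

theorem nodup_filterMap_position {W : List (Fin n)} (hW : W.Nodup) {l : List (Fin n)}
    (hl : l.Nodup) : (l.filterMap (position W)).Nodup := by
  refine hl.filterMap fun a b i ha hb => ?_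
  exact ((position_eq_some hW).1 ha).symm.trans ((position_eq_some hW).1 hb)

theorem mem_filterMap_position {W : List (Fin n)} (hW : W.Nodup) {l : List (Fin n)}
    {i : Fin W.length} : i ∈ l.filterMap (position W) ↔ W.get i ∈ l := by
  rw [List.mem_filterMap]
  constructor
  · rintro ⟨v, hv, h⟩
    rwa [(position_eq_some hW).1 h]
  · exact fun h => ⟨_, h, (position_eq_some hW).2 rfl⟩

/-- The part of the stream that is passed on to the oracle is a stream of the induced subgraph. -/
theorem isALStream_filterMap {G : SimpleGraph (Fin n)} {L : List (ALToken (Fin n))}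
    (h : IsALStream G L) {W : List (Fin n)} (hW : W.Nodup) :
    IsALStream (G.comap W.get) (L.filterMap (restrictToken W)) := by
  obtain ⟨order, nbrs, hnd, hmem, hnb, rfl⟩ := h
  refine ⟨order.filterMap (position W), fun i => (nbrs (W.get i)).filterMap (position W),
    nodup_filterMap_position hW hnd, fun i => (mem_filterMap_position hW).2 (hmem _),
    fun i => ⟨nodup_filterMap_position hW (hnb _).1, fun j => ?_⟩, ?_⟩
  · rw [mem_filterMap_position hW, (hnb _).2, SimpleGraph.comap_adj]
  · clear hnd hmem
    have hedge : ∀ (v : Fin n) (i : Fin W.length), position W v = some i → ∀ us : List (Fin n),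
        (us.map (ALToken.edge v)).filterMap (restrictToken W) =
          (us.filterMap (position W)).map (ALToken.edge i) := by
      intro v i hi us
      rw [List.filterMap_map, List.map_filterMap]
      refine List.filterMap_congr fun u _ => ?_
      unfold position at hi ⊢
      split at hi
      · rename_i hv
        simp only [Option.some.injEq] at hi
        subst hi
        by_cases hu : u ∈ W <;> simp [restrictToken, hv, hu]
      · simp at hi
    induction order with
    | nil => rfl
    | cons v order ih =>
      rw [List.flatMap_cons, List.filterMap_append, ih]
      cases hv : position W v with
      | none =>
        have hv' : v ∉ W := by
          intro hv'
          simp [position, hv'] at hv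
        rw [List.filterMap_cons_none hv]
        have : (ALToken.vertex v :: (nbrs v).map (ALToken.edge v)).filterMap (restrictToken W) =
            [] := by
          rw [List.filterMap_eq_nil_iff]
          intro t ht
          rcases List.mem_cons.1 ht with rfl | ht
          · simp [restrictToken, hv']
          · obtain ⟨u, -, rfl⟩ := List.mem_map.1 ht
            simp [restrictToken, hv']
        rw [this, List.nil_append]
      | some i =>
        rw [List.filterMap_cons_some hv, List.flatMap_cons]
        congr 1
        have hv' : restrictToken W (ALToken.vertex v) = some (ALToken.vertex i) := by
          unfold position at hv
          split at hv
          · rename_i h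
            simp only [Option.some.injEq] at hv
            subst hv
            simp [restrictToken, h]
          · simp at hv
        rw [List.filterMap_cons_some hv', hedge v i hv]
        have hi := (position_eq_some hW).1 hv
        simp only [hi]

end TwinBranching

/-! ### Twin classes and solutions -/

/-- A graph that `φ` embeds onto the vertices in `W` is isomorphic to the subgraph induced by `W`,
with the vertices renamed to their positions. -/
theorem GraphProperty.mem_comap_get (Q : GraphProperty) {V : Type} {G : SimpleGraph V} {h : ℕ}
    {H : SimpleGraph (Fin h)} {W : List V} (hW : W.Nodup) {φ : Fin h → V}
    (hφ : Function.Injective φ) (hrange : ∀ v, v ∈ W ↔ ∃ i, φ i = v)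
    (hadj : ∀ i j, G.Adj (φ i) (φ j) ↔ H.Adj i j) (hH : Q.Mem H) : Q.Mem (G.comap W.get) := by
  have hget : Function.Injective W.get := List.nodup_iff_injective_get.1 hW
  have hex : ∀ i, ∃ j, W.get j = φ i := fun i => List.mem_iff_get.1 ((hrange _).2 ⟨i, rfl⟩)
  choose ψ hψ using hex
  have hbij : Function.Bijective ψ := by
    refine ⟨fun i j e => hφ (by rw [← hψ, ← hψ, e]), fun j => ?_⟩
    obtain ⟨i, hi⟩ := (hrange _).1 (List.get_mem W j)
    exact ⟨i, hget ((hψ i).trans hi)⟩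
  refine Q.mem_of_iso H _ ⟨⟨Equiv.ofBijective ψ hbij, fun {i j} => ?_⟩⟩ hH
  rw [SimpleGraph.comap_adj, Equiv.ofBijective_apply, Equiv.ofBijective_apply, hψ, hψ, hadj]

theorem List.Nodup.count_map_eq_card {α κ : Type*} [DecidableEq α] [DecidableEq κ] [BEq κ]
    [LawfulBEq κ] {l : List α} (h : l.Nodup) (c : α → κ) (k : κ) :
    (l.map c).count k = (l.toFinset.filter fun v => c v = k).card := by
  rw [List.count, List.countP_map, List.countP_eq_length_filter,
    ← List.toFinset_card_of_nodup (h.filter _), List.toFinset_filter]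
  congr 1
  refine Finset.filter_congr fun v _ => ?_
  rw [Function.comp_apply, beq_iff_eq]

/-- A multiset of classes that are large enough can be represented by distinct elements. -/
theorem List.exists_nodup_map_perm {α κ : Type*} [DecidableEq α] [DecidableEq κ] [BEq κ]
    [LawfulBEq κ] (c : α → κ) (A : Finset α) {I : List κ}
    (hI : ∀ k, I.count k ≤ (A.filter fun v => c v = k).card) :
    ∃ Z : List α, Z.Nodup ∧ (∀ v ∈ Z, v ∈ A) ∧ (Z.map c).Perm I := by
  have h : I.Subperm (A.toList.map c) := by
    rw [List.subperm_ext_iff]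
    intro k _
    rw [A.nodup_toList.count_map_eq_card, Finset.toList_toFinset]
    exact hI k
  obtain ⟨I', hp, hs⟩ := h
  obtain ⟨Z, hZ, rfl⟩ := List.sublist_map_iff.1 hs
  exact ⟨Z, A.nodup_toList.sublist hZ, fun v hv => by simpa using hZ.subset hv, hp⟩

namespace TwinBranching

variable {n : ℕ}

/-- The part `J` of `Y` and representatives outside `X` of the twin classes in `I` induce a graph
in the property. -/
def Bad (Q : GraphProperty) (G : SimpleGraph (Fin n)) (X Y J : List (Fin n))
    (I : List (Key n)) : Prop :=
  ∃ Z : List (Fin n), Z.Nodup ∧ (∀ v ∈ Z, v ∉ X) ∧ (Z.map (classOf G Y)).Perm I ∧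
    Q.Mem (G.comap (Z ++ J).get)

/-- The number of vertices of class `k` outside `X` and `D`. -/
noncomputable def classSize (G : SimpleGraph (Fin n)) (X Y D : List (Fin n)) (k : Key n) : ℕ :=
  (Finset.univ.filter fun v => v ∉ X ++ D ∧ classOf G Y v = k).card

/-- A graph with the part `Y` of the vertex cover and `e k` vertices of each twin class `k` has no
induced subgraph in the property. -/
def FreeProfile (Q : GraphProperty) (ν : ℕ) (G : SimpleGraph (Fin n)) (X Y : List (Fin n))
    (e : Key n → ℕ) : Prop :=
  ∀ (J : List (Fin n)) (I : List (Key n)), J.Sublist Y → J.length + I.length ≤ ν →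
    (∀ k, I.count k ≤ e k) → ¬ Bad Q G X Y J I

/-- After `size` deletions, with `EC k` vertices of each twin class `k` left, one can delete
further vertices of the twin classes within the budget so that no induced subgraph in the property
remains. Only the number of vertices of each class matters, as the vertices of a class are twins. -/
def Solvable (Q : GraphProperty) (ν : ℕ) (G : SimpleGraph (Fin n)) (X Y : List (Fin n))
    (budget size : ℕ) (EC : Key n → ℕ) : Prop :=
  ∃ e : Key n → ℕ, (∀ k, e k ≤ EC k) ∧ FreeProfile Q ν G X Y e ∧
    size + ∑ k ∈ Y.sublists.toFinset, (EC k - e k) ≤ budget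

section

variable {Q : GraphProperty} {ν : ℕ} {G : SimpleGraph (Fin n)} {X Y : List (Fin n)}

theorem FreeProfile.mono {e e' : Key n → ℕ} (h : FreeProfile Q ν G X Y e)
    (hle : ∀ k, e' k ≤ e k) : FreeProfile Q ν G X Y e' :=
  fun J I hJ hn hI => h J I hJ hn fun k => (hI k).trans (hle k)

theorem nodup_append_of_subset {Z J : List (Fin n)} (hZ : Z.Nodup) (hZX : ∀ v ∈ Z, v ∉ X)
    (hJ : J.Nodup) (hJX : J ⊆ X) : (Z ++ J).Nodup :=
  List.nodup_append'.2 ⟨hZ, hJ, fun v h1 h2 => hZX v h1 (hJX h2)⟩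

/-- Vertices outside the vertex cover may be replaced by twins. -/
theorem mem_comap_of_map_eq (hX : ∀ u v, G.Adj u v → u ∈ X ∨ v ∈ X)
    {J Z Z' : List (Fin n)} (hJ : J ⊆ Y) (hZ : ∀ v ∈ Z, v ∉ X) (hZ' : ∀ v ∈ Z', v ∉ X)
    (h : Z.map (classOf G Y) = Z'.map (classOf G Y)) (hQ : Q.Mem (G.comap (Z ++ J).get)) :
    Q.Mem (G.comap (Z' ++ J).get) := by
  -- `r` relates the vertices at the same position; it preserves adjacency
  let r : Fin n → Fin n → Prop := fun a b =>
    (a = b ∧ a ∈ Y) ∨ (a ∉ X ∧ b ∉ X ∧ classOf G Y a = classOf G Y b)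
  have hr : ∀ a a' b b', r a a' → r b b' → (G.Adj a b ↔ G.Adj a' b') := by
    have hcl : ∀ u a a', u ∈ Y → classOf G Y a = classOf G Y a' → (G.Adj a u ↔ G.Adj a' u) := by
      intro u a a' hu e
      have : u ∈ classOf G Y a ↔ u ∈ classOf G Y a' := by rw [e]
      simpa [mem_classOf, hu] using this
    rintro a a' b b' (⟨rfl, ha⟩ | ⟨ha, ha', e⟩) (⟨rfl, hb⟩ | ⟨hb, hb', e'⟩)
    · rfl
    · rw [G.adj_comm, G.adj_comm a b', hcl a b b' ha e']
    · exact hcl b a a' hb e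
    · constructor
      · intro h
        rcases hX _ _ h with h | h <;> contradiction
      · intro h
        rcases hX _ _ h with h | h <;> contradiction
  have hall : List.Forall₂ r (Z ++ J) (Z' ++ J) := by
    refine List.rel_append ?_ ?_
    · clear hQ
      induction Z generalizing Z' with
      | nil =>
        cases Z' with
        | nil => exact .nil
        | cons => simp at h
      | cons a Z ih =>
        cases Z' with
        | nil => simp at h
        | cons a' Z' =>
          simp only [List.map_cons, List.cons.injEq] at h
          simp only [List.mem_cons, forall_eq_or_imp] at hZ hZ'
          exact .cons (Or.inr ⟨hZ.1, hZ'.1, h.1⟩) (ih hZ.2 hZ'.2 h.2)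
    · clear hQ
      induction J with
      | nil => exact .nil
      | cons a J ih =>
        rw [List.cons_subset] at hJ
        exact .cons (Or.inl ⟨rfl, hJ.1⟩) (ih hJ.2)
  obtain ⟨hlen, hget⟩ := List.forall₂_iff_get.1 hall
  refine Q.mem_of_iso _ _ ⟨⟨finCongr hlen, fun {i j} => ?_⟩⟩ hQ
  simp only [SimpleGraph.comap_adj]
  exact (hr _ _ _ _ (hget i i.2 (by rw [← hlen]; exact i.2))
    (hget j j.2 (by rw [← hlen]; exact j.2))).symm

/-- Whether `J` and the classes in `I` induce a graph in the property can be tested on any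
representatives. -/
theorem bad_iff (hX : ∀ u v, G.Adj u v → u ∈ X ∨ v ∈ X) (hY : Y.Nodup) (hYX : Y ⊆ X)
    {J Z : List (Fin n)} (hJ : J.Sublist Y) (hZ : Z.Nodup) (hZX : ∀ v ∈ Z, v ∉ X)
    {I : List (Key n)} (hI : (Z.map (classOf G Y)).Perm I) :
    Bad Q G X Y J I ↔ Q.Mem (G.comap (Z ++ J).get) := by
  refine ⟨?_, fun h => ⟨Z, hZ, hZX, hI, h⟩⟩
  rintro ⟨Z', -, hZX', hI', h⟩
  have hJX : J ⊆ X := fun v hv => hYX (hJ.subset hv)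
  -- reorder `Z` so that its classes come in the same order as those of `Z'`
  have hr : Relation.Comp (List.Forall₂ fun v k => classOf G Y v = k) List.Perm Z
      (Z'.map (classOf G Y)) :=
    ⟨Z.map (classOf G Y), List.forall₂_map_right_iff.2 (List.forall₂_same.2 fun _ _ => rfl),
      hI.trans hI'.symm⟩
  obtain ⟨Z'', hp, hr⟩ : (Relation.Comp List.Perm
      (List.Forall₂ fun v k => classOf G Y v = k)) Z (Z'.map (classOf G Y)) := by
    rw [← List.forall₂_comp_perm_eq_perm_comp_forall₂]
    exact hr
  have e : Z'.map (classOf G Y) = Z''.map (classOf G Y) := by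
    symm
    rw [← List.forall₂_eq_eq_eq, List.forall₂_map_left_iff]
    exact hr
  have hZX'' : ∀ v ∈ Z'', v ∉ X := fun v hv => hZX v (hp.mem_iff.2 hv)
  have h' := mem_comap_of_map_eq hX (fun v hv => hJ.subset hv) hZX' hZX'' e h
  have hnd'' := nodup_append_of_subset (hp.nodup_iff.1 hZ) hZX'' (hY.sublist hJ) hJX
  have hnd := nodup_append_of_subset hZ hZX (hY.sublist hJ) hJX
  refine Q.mem_comap_get hnd (List.nodup_iff_injective_get.1 hnd'') (fun v => ?_)
    (fun i j => Iff.rfl) h'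
  rw [(hp.append_right J).mem_iff, List.mem_iff_get]

theorem Bad.exists_classOf_eq {J : List (Fin n)} {I : List (Key n)} (h : Bad Q G X Y J I)
    {k : Key n} (hk : k ∈ I) : ∃ v, classOf G Y v = k := by
  obtain ⟨Z, -, -, hI, -⟩ := h
  obtain ⟨v, -, hv⟩ := List.mem_map.1 (hI.mem_iff.2 hk)
  exact ⟨v, hv⟩

/-- The branching rule: if the classes in `I`, together with `J`, induce a graph in the property,
then one of them has to be cut down below its multiplicity in `I`. -/
theorem solvable_iff_of_bad {budget size : ℕ} {EC : Key n → ℕ} {J : List (Fin n)}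
    {I : List (Key n)} (hJ : J.Sublist Y) (hν : J.length + I.length ≤ ν)
    (hI : ∀ k, I.count k ≤ EC k) (hbad : Bad Q G X Y J I) :
    Solvable Q ν G X Y budget size EC ↔ ∃ k ∈ I, size + (EC k - (I.count k - 1)) ≤ budget ∧
      Solvable Q ν G X Y budget (size + (EC k - (I.count k - 1)))
        (Function.update EC k (EC k - (EC k - (I.count k - 1)))) := by
  -- no truncation: the multiplicities in `I` are at most the class sizes
  have hcut : ∀ k ∈ I, EC k - (EC k - (I.count k - 1)) = I.count k - 1 := by
    intro k _
    have := hI k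
    omega
  have hmem : ∀ k ∈ I, k ∈ Y.sublists.toFinset := by
    intro k hk
    obtain ⟨v, rfl⟩ := hbad.exists_classOf_eq hk
    simpa using classOf_sublist G Y v
  have hsum : ∀ k ∈ I, ∀ e : Key n → ℕ, e k ≤ I.count k - 1 →
      (EC k - (I.count k - 1)) + ∑ k' ∈ Y.sublists.toFinset,
        (Function.update EC k (I.count k - 1) k' - e k') =
      ∑ k' ∈ Y.sublists.toFinset, (EC k' - e k') := by
    intro k hk e he
    rw [← Finset.add_sum_erase _ _ (hmem k hk), ← Finset.add_sum_erase _ _ (hmem k hk),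
      Function.update_self, ← add_assoc]
    congr 1
    · have := hI k
      omega
    · refine Finset.sum_congr rfl fun k' hk' => ?_
      rw [Function.update_of_ne (Finset.ne_of_mem_erase hk')]
  constructor
  · rintro ⟨e, hle, hfree, hs⟩
    obtain ⟨k, hk⟩ : ∃ k, e k < I.count k := by
      by_contra! hcon
      exact hfree J I hJ hν hcon hbad
    have hkI : k ∈ I := List.count_pos_iff.1 (by omega)
    have hs' := hsum k hkI e (by omega)
    refine ⟨k, hkI, by omega, e, fun k' => ?_, hfree, ?_⟩
    · rw [hcut k hkI]
      by_cases hkk : k' = k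
      · subst hkk
        rw [Function.update_self]
        omega
      · rw [Function.update_of_ne hkk]
        exact hle k'
    · rw [hcut k hkI]
      omega
  · rintro ⟨k, hkI, -, e, hle, hfree, hs⟩
    rw [hcut k hkI] at hle hs
    have hek := hle k
    rw [Function.update_self] at hek
    have hs' := hsum k hkI e hek
    refine ⟨e, fun k' => ?_, hfree, by omega⟩
    by_cases hkk : k' = k
    · subst hkk
      have := hI k'
      omega
    · simpa [Function.update_of_ne hkk] using hle k'

theorem Solvable.of_free {budget size : ℕ} {EC : Key n → ℕ} (h : FreeProfile Q ν G X Y EC)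
    (hs : size ≤ budget) : Solvable Q ν G X Y budget size EC :=
  ⟨EC, fun _ => le_rfl, h, by simpa using hs⟩

theorem Solvable.not_bad_nil {budget size : ℕ} {EC : Key n → ℕ}
    (h : Solvable Q ν G X Y budget size EC) {J : List (Fin n)} (hJ : J.Sublist Y)
    (hν : J.length ≤ ν) : ¬ Bad Q G X Y J [] := by
  obtain ⟨e, -, hf, -⟩ := h
  exact hf J [] hJ (by simpa using hν) (by simp)

/-- Freeness of what remains after the deletion of `D`, in terms of the sizes of the twin
classes that remain. -/
theorem free_induce_iff (hν : ∀ (h : ℕ) (H : SimpleGraph (Fin h)), Q.Mem H → h ≤ ν)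
    (hX : ∀ u v, G.Adj u v → u ∈ X ∨ v ∈ X) (hXn : X.Nodup) (D : Finset (Fin n))
    (hY : ∀ v, v ∈ Y ↔ v ∈ X ∧ v ∉ D) (hYX : Y.Sublist X) :
    Q.Free (G.induce ((D : Set (Fin n))ᶜ)) ↔ FreeProfile Q ν G X Y fun k =>
      ((Finset.univ.filter fun v => v ∉ X ∧ v ∉ D).filter fun v => classOf G Y v = k).card := by
  have hYn := hXn.sublist hYX
  constructor
  · intro hfree J I hJ hn hI hbad
    obtain ⟨Z, hZ, hZA, hp⟩ := List.exists_nodup_map_perm (classOf G Y) _ hI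
    simp only [Finset.mem_filter, Finset.mem_univ, true_and] at hZA
    have hnd := nodup_append_of_subset hZ (fun v hv => (hZA v hv).1) (hYn.sublist hJ)
      (fun v hv => hYX.subset (hJ.subset hv))
    rw [bad_iff hX hYn hYX.subset hJ hZ (fun v hv => (hZA v hv).1) hp] at hbad
    refine hfree _ _ hbad ⟨⟨⟨fun i => ⟨(Z ++ J).get i, ?_⟩, ?_⟩, ?_⟩⟩
    · have hi := List.get_mem (Z ++ J) i
      simp only [Set.mem_compl_iff, Finset.mem_coe]
      rcases List.mem_append.1 hi with hi | hi
      · exact (hZA _ hi).2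
      · exact ((hY _).1 (hJ.subset hi)).2
    · intro i j e
      exact List.nodup_iff_injective_get.1 hnd (Subtype.ext_iff.1 e)
    · intro i j
      rfl
  · rintro hfree h H hH ⟨φ⟩
    -- split the image of the embedding into its part in `Y` and its part outside `X`
    let T : Finset (Fin n) := Finset.univ.image fun i => (φ i).1
    have hT : ∀ v, v ∈ T ↔ ∃ i, (φ i).1 = v := fun v => by simp [T]
    have hTD : ∀ v ∈ T, v ∉ D := by
      intro v hv
      obtain ⟨i, rfl⟩ := (hT v).1 hv
      exact (φ i).2
    let J := Y.filter fun v => v ∈ T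
    let Z := (T.filter fun v => v ∉ X).toList
    have hJ : J.Sublist Y := List.filter_sublist
    have hZ : Z.Nodup := Finset.nodup_toList _
    have hZT : ∀ v, v ∈ Z ↔ v ∈ T ∧ v ∉ X := fun v => by simp [Z]
    have hnd : (Z ++ J).Nodup := nodup_append_of_subset hZ (fun v hv => ((hZT v).1 hv).2)
      (hYn.sublist hJ) (fun v hv => hYX.subset (hJ.subset hv))
    have hW : ∀ v, v ∈ Z ++ J ↔ ∃ i, (φ i).1 = v := by
      intro v
      rw [← hT, List.mem_append, hZT, List.mem_filter, hY]
      constructor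
      · rintro (h | h)
        · exact h.1
        · simpa using h.2
      · intro h
        by_cases hv : v ∈ X
        · exact Or.inr ⟨⟨hv, hTD v h⟩, by simpa using h⟩
        · exact Or.inl ⟨h, hv⟩
    have hmem : Q.Mem (G.comap (Z ++ J).get) :=
      Q.mem_comap_get hnd (φ := fun i => (φ i).1)
        (fun i j e => φ.injective (Subtype.ext e)) hW (fun i j => φ.map_rel_iff) hH
    refine hfree J (Z.map (classOf G Y)) hJ ?_ (fun k => ?_)
      ⟨Z, hZ, fun v hv => ((hZT v).1 hv).2, .refl _, hmem⟩
    · have := hν _ _ hmem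
      rw [List.length_append] at this
      rw [List.length_map]
      omega
    · rw [hZ.count_map_eq_card]
      refine Finset.card_le_card fun v hv => ?_
      simp only [Finset.mem_filter, List.mem_toFinset, Finset.mem_univ, true_and, hZT] at hv ⊢
      exact ⟨⟨hv.1.2, hTD v hv.1.1⟩, hv.2⟩

/-- The solutions, by their part in the vertex cover. -/
theorem deletable_iff (hν : ∀ (h : ℕ) (H : SimpleGraph (Fin h)), Q.Mem H → h ≤ ν)
    (hX : ∀ u v, G.Adj u v → u ∈ X ∨ v ∈ X) (hXn : X.Nodup) (b : ℕ) :
    Q.Deletable G b ↔ ∃ S ∈ dictSubsets b X,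
      Solvable Q ν G X (X.filter fun x => x ∉ S) b S.length
        (classSize G X (X.filter fun x => x ∉ S) []) := by
  constructor
  · rintro ⟨D, hD, hfree⟩
    let S := X.filter fun x => x ∈ D
    have hSX : S.Sublist X := List.filter_sublist
    have hSD : S.toFinset = D.filter fun v => v ∈ X := by
      ext v
      simp [S, and_comm]
    have hSc : S.length = (D.filter fun v => v ∈ X).card := by
      rw [← hSD, List.toFinset_card_of_nodup (hXn.sublist hSX)]
    have hcard := Finset.card_filter_add_card_filter_not (s := D) (fun v => v ∈ X)
    refine ⟨S, mem_dictSubsets.2 ⟨by omega, hSX⟩, ?_⟩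
    set Y := X.filter fun x => x ∉ S with hYdef
    have hY : ∀ v, v ∈ Y ↔ v ∈ X ∧ v ∉ D := by
      intro v
      simp only [hYdef, S, List.mem_filter, decide_eq_true_eq]
      grind
    refine ⟨_, fun k => ?_, (free_induce_iff hν hX hXn D hY List.filter_sublist).1 hfree, ?_⟩
    · refine Finset.card_le_card fun v hv => ?_
      simp only [Finset.mem_filter, Finset.mem_univ, true_and, List.append_nil] at hv ⊢
      exact ⟨hv.1.1, hv.2⟩
    · have h1 : ∀ k ∈ Y.sublists.toFinset, classSize G X Y [] k -
          ((Finset.univ.filter fun v => v ∉ X ∧ v ∉ D).filter fun v => classOf G Y v = k).card ≤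
          ((D.filter fun v => ¬ v ∈ X).filter fun v => classOf G Y v = k).card := by
        intro k _
        rw [Nat.sub_le_iff_le_add, ← Finset.card_union_of_disjoint]
        · refine Finset.card_le_card fun v hv => ?_
          simp only [Finset.mem_filter, Finset.mem_univ, true_and, List.append_nil,
            Finset.mem_union] at hv ⊢
          tauto
        · rw [Finset.disjoint_left]
          intro v h1 h2
          simp only [Finset.mem_filter, Finset.mem_univ, true_and] at h1 h2
          exact h2.1.2 h1.1.1
      have h2 := Finset.sum_le_sum h1
      rw [← Finset.card_eq_sum_card_fiberwise
        (fun v _ => by simpa using classOf_sublist G Y v)] at h2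
      omega
  · rintro ⟨S, hS, e, hle, hfree, hsum⟩
    rw [mem_dictSubsets] at hS
    set Y := X.filter fun x => x ∉ S with hYdef
    have hex : ∀ k, ∃ B ⊆ Finset.univ.filter fun v => v ∉ X ++ [] ∧ classOf G Y v = k,
        B.card = classSize G X Y [] k - e k :=
      fun k => Finset.exists_subset_card_eq (Nat.sub_le _ _)
    choose B hB hBc using hex
    simp only [List.append_nil] at hB
    -- delete `S` and any `classSize k - e k` vertices of each class `k`
    let D := S.toFinset ∪ Y.sublists.toFinset.biUnion B
    have hBX : ∀ k, ∀ v ∈ B k, v ∉ X ∧ classOf G Y v = k := by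
      intro k v hv
      simpa using hB k hv
    have hDmem : ∀ v, v ∈ D ↔ v ∈ S ∨ v ∈ B (classOf G Y v) := by
      intro v
      simp only [D, Finset.mem_union, List.mem_toFinset, Finset.mem_biUnion, List.mem_sublists]
      refine or_congr_right ⟨?_, fun h => ⟨_, classOf_sublist G Y v, h⟩⟩
      rintro ⟨k, -, hk⟩
      rwa [(hBX k v hk).2]
    have hY : ∀ v, v ∈ Y ↔ v ∈ X ∧ v ∉ D := by
      intro v
      rw [hDmem, hYdef, List.mem_filter, decide_eq_true_eq, not_or]
      exact ⟨fun h => ⟨h.1, h.2, fun h' => (hBX _ v h').1 h.1⟩, fun h => ⟨h.1, h.2.1⟩⟩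
    refine ⟨D, ?_, (free_induce_iff hν hX hXn D hY List.filter_sublist).2 (hfree.mono ?_)⟩
    · refine (Finset.card_union_le _ _).trans (le_trans ?_ hsum)
      refine Nat.add_le_add (List.toFinset_card_le _) (Finset.card_biUnion_le.trans ?_)
      exact Finset.sum_le_sum fun k _ => (hBc k).le
    · intro k
      have h1 : ((Finset.univ.filter fun v => v ∉ X ∧ v ∉ D).filter
          fun v => classOf G Y v = k) ⊆
          (Finset.univ.filter fun v => v ∉ X ++ [] ∧ classOf G Y v = k) \ B k := by
        intro v hv
        simp only [Finset.mem_filter, Finset.mem_univ, true_and, Finset.mem_sdiff,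
          List.append_nil] at hv ⊢
        refine ⟨⟨hv.1.1, hv.2⟩, fun h => hv.1.2 ((hDmem v).2 (Or.inr ?_))⟩
        rwa [hv.2]
      refine (Finset.card_le_card h1).trans ?_
      rw [Finset.card_sdiff_of_subset (by simpa using hB k), hBc]
      have := hle k
      rw [classSize] at *
      omega

/-- Budgets above the size of the vertex cover are pointless if every graph in the property has an
edge. -/
theorem deletable_min_iff (hX : ∀ u v, G.Adj u v → u ∈ X ∨ v ∈ X) (hXn : X.Nodup) {ℓ : ℕ}
    (h : ℓ ≤ X.length ∨ ∀ (h : ℕ) (H : SimpleGraph (Fin h)), Q.Mem H → ∃ u v, H.Adj u v) :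
    Q.Deletable G (min ℓ X.length) ↔ Q.Deletable G ℓ := by
  rcases le_or_gt ℓ X.length with hl | hl
  · rw [min_eq_left hl]
  · have hedge := h.resolve_left (by omega)
    have hdel : ∀ b, X.length ≤ b → Q.Deletable G b := by
      intro b hb
      refine ⟨X.toFinset, by rwa [List.toFinset_card_of_nodup hXn], ?_⟩
      rintro k H hH ⟨φ⟩
      obtain ⟨u, v, huv⟩ := hedge k H hH
      have h1 : G.Adj (φ u).1 (φ v).1 := φ.map_rel_iff.2 huv
      have h2 := (φ u).2
      have h3 := (φ v).2
      simp only [List.coe_toFinset, Set.mem_compl_iff, Set.mem_ofPred_eq] at h2 h3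
      rcases hX _ _ h1 with h | h <;> contradiction
    exact iff_of_true (hdel _ (by omega)) (hdel _ hl.le)

end

end TwinBranching

/-! ### The states of the algorithm -/

theorem StreamAlg.Visits.foldl {ι τ : Type} {A : StreamAlg ι τ} {i : ι} {L l r : List τ}
    {s : A.State} (h : A.Visits i L s (l ++ r)) : A.Visits i L (l.foldl A.step s) r := by
  induction l generalizing s with
  | nil => exact h
  | cons t l ih => exact ih (.step h)

namespace TwinBranching

variable {n : ℕ} {A : GraphOracle}

/-- The part of `Y` that a task is about. -/
def Task.J : Task n → List (Fin n)
  | .check J => J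
  | .search _ J _ => J

/-- The twin classes of which a task takes vertices. -/
def Task.I : Task n → List (Key n)
  | .check _ => []
  | .search _ _ I => I

/-- Every branching has deleted at least one vertex, and only vertices of the class that it has cut
down, outside the vertex cover, and not deleted before. -/
def StackGood (G : SimpleGraph (Fin n)) (X Y : List (Fin n)) :
    List (Key n × List (Fin n)) → Prop
  | [] => True
  | (k, VS) :: st => VS ≠ [] ∧ VS.Nodup ∧
      (∀ v ∈ VS, v ∉ X ++ st.flatMap Prod.snd ∧ classOf G Y v = k) ∧ StackGood G X Y st

/-- A node that can occur in the search on the graph `G`. -/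
structure NodeGood (G : SimpleGraph (Fin n)) (m : Mem A n) (N : Node n) : Prop where
  stack : StackGood G m.X m.Y N.stack
  sizes : N.EC = classSize G m.X m.Y N.deleted
  size_le : m.S.length + N.deleted.length ≤ m.budget
  resume : ∀ k ∈ N.resume, k.Sublist m.Y

/-- A task that can occur on the graph `G`. -/
def TaskGood (ν : ℕ) (G : SimpleGraph (Fin n)) (m : Mem A n) : Task n → Prop
  | .check J => J ∈ dictSubsets ν m.Y
  | .search N J I => NodeGood G m N ∧ J ∈ dictSubsets ν m.Y ∧
      I ∈ dictPicks (ν - J.length) (m.classes N.EC)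

/-- A phase with which a pass over the stream `L` of the graph `G` can begin. -/
def PhaseGood (ν : ℕ) (G : SimpleGraph (Fin n)) (L : List (ALToken (Fin n))) (m : Mem A n) :
    Phase A n → Prop
  | .start => False
  | .count r => r = ⟨fun _ => 0, none⟩
  | .pick T r => TaskGood ν G m T ∧ r = ⟨(T.I, T.J), none⟩
  | .ask T W s => TaskGood ν G m T ∧ W.Nodup ∧ W.length ≤ ν ∧
      (A W.length).Visits () (L.filterMap (restrictToken W)) s (L.filterMap (restrictToken W))
  | .delete N k r => NodeGood G m N ∧ k.Sublist m.Y ∧ ∃ c, 1 ≤ c ∧ c ≤ N.EC k ∧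
      m.S.length + N.deleted.length + c ≤ m.budget ∧ r = ⟨(List.replicate c k, []), none⟩

/-- The parts of a state that do not change in a pass belong to the vertex cover `X` and the
budget `b`. -/
structure MemBase (X : List (Fin n)) (b : ℕ) (m : Mem A n) : Prop where
  X_eq : m.X = X
  budget_eq : m.budget = b
  S_mem : m.S ∈ dictSubsets b X

/-- A state with which a pass over the stream `L` of the graph `G` can begin. -/
structure MemGood (ν : ℕ) (G : SimpleGraph (Fin n)) (L : List (ALToken (Fin n)))
    (X : List (Fin n)) (b : ℕ) (m : Mem A n) : Prop extends MemBase X b m where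
  phase : PhaseGood ν G L m m.phase

/-- The outcome of a transition between two passes is a halt or a good state. -/
def OutcomeGood (ν : ℕ) (G : SimpleGraph (Fin n)) (L : List (ALToken (Fin n)))
    (X : List (Fin n)) (b : ℕ) : Mem A n ⊕ Bool → Prop
  | .inl m => MemGood ν G L X b m
  | .inr _ => True

/-! ### Passes, phase by phase -/

section Passes

theorem foldl_step_count (l : List (ALToken (Fin n))) (m : Mem A n) (r : Reader n (Key n → ℕ)) :
    l.foldl Mem.step ({ m with phase := .count r } : Mem A n) =
      ({ m with phase := .count (l.foldl (Reader.step m.Y (countVertex m.X)) r) } : Mem A n) := by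
  induction l generalizing r with
  | nil => rfl
  | cons t l ih => exact ih _

theorem foldl_step_pick (l : List (ALToken (Fin n))) (m : Mem A n) (T : Task n)
    (r : Reader n (List (Key n) × List (Fin n))) :
    l.foldl Mem.step ({ m with phase := .pick T r } : Mem A n) = ({ m with
      phase := .pick T
        (l.foldl (Reader.step m.Y (collectVertex (m.unavailable T))) r) } : Mem A n) := by
  induction l generalizing r with
  | nil => rfl
  | cons t l ih =>
    refine Eq.trans ?_ (ih _)
    cases T <;> rfl

theorem foldl_step_delete (l : List (ALToken (Fin n))) (m : Mem A n) (N : Node n) (k : Key n)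
    (r : Reader n (List (Key n) × List (Fin n))) :
    l.foldl Mem.step ({ m with phase := .delete N k r } : Mem A n) = ({ m with
      phase := .delete N k
        (l.foldl (Reader.step m.Y (collectVertex (m.X ++ N.deleted))) r) } : Mem A n) := by
  induction l generalizing r with
  | nil => rfl
  | cons t l ih => exact ih _

theorem foldl_step_ask (l : List (ALToken (Fin n))) (m : Mem A n) (T : Task n)
    (W : List (Fin n)) (s : (A W.length).State) :
    l.foldl Mem.step ({ m with phase := .ask T W s } : Mem A n) = ({ m with
      phase := .ask T W
        ((l.filterMap (restrictToken W)).foldl (A W.length).step s) } : Mem A n) := by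
  induction l generalizing s with
  | nil => rfl
  | cons t l ih =>
    rw [List.foldl_cons]
    cases ht : restrictToken W t with
    | none =>
      rw [List.filterMap_cons_none ht, ← ih]
      congr 1
      simp [Mem.step, ht]
    | some t' =>
      rw [List.filterMap_cons_some ht, List.foldl_cons, ← ih]
      congr 1
      simp [Mem.step, ht]

end Passes

section Counts

variable {G : SimpleGraph (Fin n)} {m : Mem A n} {EC : Key n → ℕ}

theorem flatMap_classes (m : Mem A n) (EC : Key n → ℕ) :
    ((m.classes EC).flatMap fun p => List.replicate p.2 p.1) =
      (dictSubsets m.Y.length m.Y).flatMap fun k => List.replicate (EC k) k := by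
  rw [Mem.classes, List.flatMap_map]

theorem count_flatMap_replicate {κ : Type} [BEq κ] [LawfulBEq κ] {ks : List κ}
    (h : ks.Nodup) (c : κ → ℕ) (k : κ) :
    (k ∉ ks → (ks.flatMap fun k => List.replicate (c k) k).count k = 0) ∧
      (k ∈ ks → (ks.flatMap fun k => List.replicate (c k) k).count k = c k) := by
  induction ks with
  | nil => simp
  | cons a ks ih =>
    rw [List.nodup_cons] at h
    obtain ⟨h1, h2⟩ := ih h.2
    rw [List.flatMap_cons, List.count_append, List.count_replicate]
    by_cases hk : k = a
    · subst hk
      simp [h1 h.1]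
    · have hka : (a == k) = false := beq_eq_false_iff_ne.2 (Ne.symm hk)
      simp only [List.mem_cons, hk, false_or, hka]
      exact ⟨fun h => by simp [h1 h], fun h => by simp [h2 h]⟩

theorem mem_subsets_Y {k : Key n} : k ∈ dictSubsets m.Y.length m.Y ↔ k.Sublist m.Y := by
  rw [mem_dictSubsets]
  exact ⟨fun h => h.2, fun h => ⟨h.length_le, h⟩⟩

theorem count_le_of_mem_dictPicks (hY : m.Y.Nodup) {j : ℕ} {I : List (Key n)}
    (hI : I ∈ dictPicks j (m.classes EC)) (k : Key n) : I.count k ≤ EC k := by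
  rw [mem_dictPicks, flatMap_classes] at hI
  refine (hI.2.count_le k).trans ?_
  obtain ⟨h1, h2⟩ := count_flatMap_replicate (nodup_dictSubsets (k := m.Y.length) hY) EC k
  by_cases hk : k ∈ dictSubsets m.Y.length m.Y
  · exact (h2 hk).le
  · rw [h1 hk]
    exact Nat.zero_le _

theorem sublist_of_mem_dictPicks {j : ℕ} {I : List (Key n)}
    (hI : I ∈ dictPicks j (m.classes EC)) {k : Key n} (hk : k ∈ I) : k.Sublist m.Y := by
  rw [mem_dictPicks, flatMap_classes] at hI
  obtain ⟨k', hk', h⟩ := List.mem_flatMap.1 (hI.2.subset hk)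
  rw [List.eq_of_mem_replicate h]
  exact mem_subsets_Y.1 hk'

/-- Every multiset of available classes occurs, in some order, among the picks. -/
theorem exists_perm_mem_dictPicks (hY : m.Y.Nodup) {j : ℕ} {I : List (Key n)}
    (hj : I.length ≤ j) (hI : ∀ k ∈ I, k.Sublist m.Y ∧ I.count k ≤ EC k) :
    ∃ I' ∈ dictPicks j (m.classes EC), I'.Perm I := by
  have h : I.Subperm ((dictSubsets m.Y.length m.Y).flatMap fun k => List.replicate (EC k) k) := by
    rw [List.subperm_ext_iff]
    intro k hk
    rw [(count_flatMap_replicate (nodup_dictSubsets hY) EC k).2 (mem_subsets_Y.2 (hI k hk).1)]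
    exact (hI k hk).2
  obtain ⟨I', hp, hs⟩ := h
  exact ⟨I', mem_dictPicks.2 ⟨hp.length_eq ▸ hj, by rwa [flatMap_classes]⟩, hp⟩

theorem nodup_classes (hY : m.Y.Nodup) : ((m.classes EC).map Prod.fst).Nodup := by
  simpa [Mem.classes, Function.comp_def] using nodup_dictSubsets hY

theorem nil_mem_dictPicks {κ : Type} (k : ℕ) (ec : List (κ × ℕ)) : [] ∈ dictPicks k ec :=
  mem_dictPicks.2 ⟨Nat.zero_le _, List.nil_sublist _⟩

theorem nil_mem_dictSubsets {κ : Type} (k : ℕ) (U : List κ) : [] ∈ dictSubsets k U :=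
  nil_mem_dictPicks _ _

/-- Deleting vertices of one class changes the size of this class only. -/
theorem classSize_append {X Y D VS : List (Fin n)} {k : Key n} (hVS : VS.Nodup)
    (h : ∀ v ∈ VS, v ∉ X ++ D ∧ classOf G Y v = k) :
    classSize G X Y D = Function.update (classSize G X Y (VS ++ D)) k
      (classSize G X Y (VS ++ D) k + VS.length) := by
  funext k'
  by_cases hk : k' = k
  · subst hk
    rw [Function.update_self, ← List.toFinset_card_of_nodup hVS, classSize, classSize,
      ← Finset.card_union_of_disjoint]
    · congr 1
      ext v
      have := h v
      simp only [List.mem_append, not_or, Finset.mem_filter, Finset.mem_univ, true_and,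
        Finset.mem_union, List.mem_toFinset] at this ⊢
      by_cases hv : v ∈ VS
      · simp [hv, this hv]
      · simp [hv]
    · rw [Finset.disjoint_left]
      intro v h1 h2
      simp only [List.mem_append, not_or, Finset.mem_filter, Finset.mem_univ, true_and,
        List.mem_toFinset] at h1 h2
      exact h1.1.2.1 h2
  · rw [Function.update_of_ne hk, classSize, classSize]
    congr 1
    refine Finset.filter_congr fun v _ => ?_
    simp only [List.mem_append, not_or]
    constructor
    · rintro ⟨⟨h1, h2⟩, h3⟩
      exact ⟨⟨h1, fun hv => hk ((h v hv).2 ▸ h3.symm), h2⟩, h3⟩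
    · rintro ⟨⟨h1, h2, h3⟩, h4⟩
      exact ⟨⟨h1, h3⟩, h4⟩

end Counts

/-! ### Transitions between passes -/

section Transitions

variable {ν : ℕ} {G : SimpleGraph (Fin n)} {L : List (ALToken (Fin n))} {X : List (Fin n)}
  {b : ℕ} {m : Mem A n} {N : Node n}

theorem MemBase.nodup_Y (h : MemBase X b m) (hX : X.Nodup) : m.Y.Nodup := by
  have := h.X_eq
  subst this
  exact hX.filter _

theorem NodeGood.with_phase (h : NodeGood G m N) (ph : Phase A n) :
    NodeGood G ({ m with phase := ph } : Mem A n) N := ⟨h.1, h.2, h.3, h.4⟩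

theorem TaskGood.with_phase {T : Task n} (h : TaskGood ν G m T) (ph : Phase A n) :
    TaskGood ν G ({ m with phase := ph } : Mem A n) T := by
  cases T with
  | check J => exact h
  | search N J I => exact ⟨h.1.with_phase ph, h.2⟩

theorem MemBase.with_phase (h : MemBase X b m) (ph : Phase A n) :
    MemBase X b ({ m with phase := ph } : Mem A n) := ⟨h.1, h.2, h.3⟩

theorem query_good (h : MemBase X b m) {T : Task n} (hT : TaskGood ν G m T) :
    OutcomeGood ν G L X b (.inl (m.query T)) := by
  refine ⟨h.with_phase _, hT.with_phase _, ?_⟩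
  cases T <;> rfl

theorem nextCover_good (h : MemBase X b m) : OutcomeGood ν G L X b m.nextCover := by
  unfold Mem.nextCover
  split
  · rename_i S' hS'
    have := mem_of_dictNext hS'
    rw [h.X_eq, h.budget_eq] at this
    exact query_good (m := { m with S := S' }) ⟨h.1, h.2, this⟩ (T := .check _) (nil_mem_dictSubsets _ _)
  · trivial

/-- Undoing the latest deletion restores the class sizes of the parent. -/
theorem NodeGood.parent {k : Key n} {VS : List (Fin n)} {st : List (Key n × List (Fin n))}
    {EC : Key n → ℕ} {res : Option (Key n)} (h : NodeGood G m ⟨EC, (k, VS) :: st, res⟩) :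
    NodeGood G m ⟨Function.update EC k (EC k + VS.length), st, some k⟩ := by
  obtain ⟨⟨h1, h2, h3, h4⟩, h5, h6, -⟩ := h
  have hd : (⟨EC, (k, VS) :: st, res⟩ : Node n).deleted = VS ++ st.flatMap Prod.snd := rfl
  rw [hd] at h5 h6
  simp only at h5
  refine ⟨h4, ?_, ?_, ?_⟩
  · simp only [Node.deleted]
    rw [classSize_append h2 h3, h5]
  · simp only [Node.deleted]
    rw [List.length_append] at h6
    omega
  · rintro k' hk'
    obtain rfl : k = k' := by simpa using hk'
    obtain ⟨v, hv⟩ := List.exists_mem_of_ne_nil VS h1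
    exact (h3 v hv).2 ▸ classOf_sublist _ _ _

theorem fail_good (h : MemBase X b m) (hN : NodeGood G m N) :
    OutcomeGood ν G L X b (m.fail N) := by
  unfold Mem.fail
  split
  · exact nextCover_good h
  · rename_i k VS st hst
    refine query_good h ⟨?_, nil_mem_dictSubsets _ _, nil_mem_dictPicks _ _⟩
    obtain ⟨EC, stack, res⟩ := N
    subst hst
    exact hN.parent

/-- A deletion that is permitted by the budget. -/
theorem delete_phase_good (h : MemBase X b m) (hX : X.Nodup) (hN : NodeGood G m N) {j : ℕ}
    {I : List (Key n)} (hI : I ∈ dictPicks j (m.classes N.EC)) {k : Key n} (hk : k ∈ I)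
    (hb : m.S.length + N.deleted.length + (N.EC k - (I.count k - 1)) ≤ m.budget) :
    MemGood ν G L X b ({ m with
      phase := .delete N k
        ⟨(List.replicate (N.EC k - (I.count k - 1)) k, []), none⟩ } : Mem A n) := by
  have h1 := count_le_of_mem_dictPicks (h.nodup_Y hX) hI k
  have h2 := List.count_pos_iff.2 hk
  exact ⟨h.with_phase _, hN.with_phase _, sublist_of_mem_dictPicks hI hk, _, by omega,
    Nat.sub_le _ _, hb, rfl⟩

theorem branch_good (h : MemBase X b m) (hX : X.Nodup) (hN : NodeGood G m N) {j : ℕ}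
    {I : List (Key n)} (hI : I ∈ dictPicks j (m.classes N.EC)) :
    OutcomeGood ν G L X b (m.branch N I) := by
  unfold Mem.branch
  simp only
  split
  · exact fail_good h hN
  · split
    · exact fail_good h hN
    · rename_i k hk
      have h1 := List.find?_some hk
      have h2 := List.mem_of_find?_eq_some hk
      refine delete_phase_good h hX hN hI (k := k) ?_ (by simpa using h1)
      split at h2
      · exact List.mem_dedup.1 h2
      · exact List.mem_dedup.1 (List.mem_of_mem_drop h2)

theorem answer_good (h : MemBase X b m) (hX : X.Nodup) {T : Task n} (hT : TaskGood ν G m T)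
    (a : Bool) : OutcomeGood ν G L X b (m.answer ν T a) := by
  unfold Mem.answer
  split
  · exact nextCover_good h
  · split
    · rename_i J' hJ'
      exact query_good h (T := .check _) (mem_of_dictNext hJ')
    · exact ⟨h.with_phase _, rfl⟩
  · exact branch_good h hX hT.1 hT.2.2
  · split
    · rename_i I' hI'
      exact query_good h (T := .search _ _ _) ⟨hT.1, hT.2.1, mem_of_dictNext hI'⟩
    · split
      · rename_i J' hJ'
        exact query_good h (T := .search _ _ _)
          ⟨hT.1, mem_of_dictNext hJ', nil_mem_dictPicks _ _⟩
      · trivial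

theorem consult_good (h : MemBase X b m) (hX : X.Nodup) {T : Task n} (hT : TaskGood ν G m T)
    {W : List (Fin n)} (hW : W.Nodup) (hν : W.length ≤ ν) {s : (A W.length).State}
    (hs : (A W.length).Visits () (L.filterMap (restrictToken W)) s []) :
    OutcomeGood ν G L X b (m.consult ν T W s) := by
  unfold Mem.consult
  split
  · rename_i s' hs'
    exact ⟨h.with_phase _, hT.with_phase _, hW, hν, .next hs hs'⟩
  · exact answer_good h hX hT _

/-- The vertices that are found for a task. -/
theorem pick_result (h : MemBase X b m) (hX : X.Nodup) (hL : IsALStream G L) {T : Task n}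
    (hT : TaskGood ν G m T) : ∃ Z : List (Fin n),
      ((L.foldl (Reader.step m.Y (collectVertex (m.unavailable T)))
        ⟨(T.I, T.J), none⟩).flush m.Y (collectVertex (m.unavailable T))).2 = Z ++ T.J ∧
      Z.Nodup ∧ (∀ v ∈ Z, v ∉ X) ∧ (Z.map (classOf G m.Y)).Perm T.I ∧
      T.J.Sublist m.Y ∧ (Z ++ T.J).Nodup ∧ (Z ++ T.J).length ≤ ν := by
  obtain ⟨order, hnd, hmem, hfold⟩ := exists_order_of_isALStream hL
  have hJ : T.J ∈ dictSubsets ν m.Y := by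
    cases T
    · exact hT
    · exact hT.2.1
  have hI : (∀ k, T.I.count k ≤ (Finset.univ.filter fun v => v ∉ m.unavailable T ∧
      classOf G m.Y v = k).card) ∧ T.I.length + T.J.length ≤ ν := by
    rw [mem_dictSubsets] at hJ
    cases T with
    | check J => exact ⟨by simp [Task.I], by simpa [Task.I] using hJ.1⟩
    | search N J I =>
      obtain ⟨hN, -, hI⟩ := hT
      refine ⟨fun k => ?_, ?_⟩
      · refine (count_le_of_mem_dictPicks (h.nodup_Y hX) hI k).trans (le_of_eq ?_)
        rw [hN.sizes]
        rfl
      · have h1 := (mem_dictPicks.1 hI).1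
        have h2 : J.length ≤ ν := hJ.1
        change I.length + J.length ≤ ν
        omega
  obtain ⟨Z, h1, h2, h3, h4⟩ := exists_foldl_collectVertex (m.unavailable T) (classOf G m.Y)
    hnd hmem T.J hI.1
  have hZX : ∀ v ∈ Z, v ∉ X := by
    intro v hv hvX
    refine h3 v hv ?_
    rw [← h.X_eq] at hvX
    cases T
    · exact hvX
    · exact List.mem_append_left _ hvX
  have hJY := (mem_dictSubsets.1 hJ).2
  refine ⟨Z, by rw [hfold, h1], h2, hZX, h4, hJY, ?_, ?_⟩
  · refine nodup_append_of_subset h2 hZX ((h.nodup_Y hX).sublist hJY) fun v hv => ?_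
    rw [← h.X_eq]
    exact (List.mem_filter.1 (hJY.subset hv)).1
  · rw [List.length_append, ← List.length_map (classOf G m.Y), h4.length_eq]
    exact hI.2

/-- The vertices that are deleted at a branching. -/
theorem delete_result (hL : IsALStream G L) (hN : NodeGood G m N) {k : Key n} {c : ℕ}
    (hc : 1 ≤ c) (hck : c ≤ N.EC k) (hb : m.S.length + N.deleted.length + c ≤ m.budget) :
    ∃ VS : List (Fin n),
      ((L.foldl (Reader.step m.Y (collectVertex (m.X ++ N.deleted)))
        ⟨(List.replicate c k, []), none⟩).flush m.Y (collectVertex (m.X ++ N.deleted))).2 = VS ∧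
      VS.length = c ∧ NodeGood G m
        ⟨Function.update N.EC k (N.EC k - VS.length), (k, VS) :: N.stack, none⟩ := by
  obtain ⟨order, hnd, hmem, hfold⟩ := exists_order_of_isALStream hL
  obtain ⟨VS, h1, h2, h3, h4⟩ := exists_foldl_collectVertex (m.X ++ N.deleted) (classOf G m.Y)
    hnd hmem (I := List.replicate c k) [] (by
      intro k'
      rw [List.count_replicate]
      split
      · rename_i hk
        obtain rfl : k = k' := by simpa using hk
        rw [hN.sizes] at hck
        exact hck
      · exact Nat.zero_le _)
  have hlen : VS.length = c := by
    rw [← List.length_map (classOf G m.Y), h4.length_eq, List.length_replicate]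
  have hcl : ∀ v ∈ VS, v ∉ m.X ++ N.deleted ∧ classOf G m.Y v = k := fun v hv =>
    ⟨h3 v hv, List.eq_of_mem_replicate (h4.mem_iff.1 (List.mem_map_of_mem hv))⟩
  refine ⟨VS, by rw [hfold, h1, List.append_nil], hlen, ⟨?_, h2, hcl, hN.stack⟩, ?_, ?_, by simp⟩
  · rintro rfl
    simp at hlen
    omega
  · have hd : (⟨Function.update N.EC k (N.EC k - VS.length), (k, VS) :: N.stack, none⟩ :
        Node n).deleted = VS ++ N.deleted := rfl
    rw [hd]
    simp only [hN.sizes, classSize_append h2 hcl]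
    simp
  · have hd : (⟨Function.update N.EC k (N.EC k - VS.length), (k, VS) :: N.stack, none⟩ :
        Node n).deleted = VS ++ N.deleted := rfl
    rw [hd, List.length_append]
    omega

/-- The first pass of a search determines the sizes of the twin classes. -/
theorem count_result (h : MemBase X b m) (hL : IsALStream G L) : NodeGood G m
      ⟨(L.foldl (Reader.step m.Y (countVertex m.X)) ⟨fun _ => 0, none⟩).flush m.Y
        (countVertex m.X), [], none⟩ := by
  obtain ⟨order, hnd, hmem, hfold⟩ := exists_order_of_isALStream hL
  refine ⟨trivial, ?_, ?_, by simp⟩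
  · rw [hfold]
    funext k
    change order.foldl (fun a v => countVertex m.X a v (classOf G m.Y v)) (fun _ => 0) k = _
    rw [foldl_countVertex m.X _ hnd, classSize, Nat.zero_add]
    congr 1
    ext v
    simp [hmem v, Node.deleted]
  · simpa [Node.deleted, h.budget_eq] using (mem_dictSubsets.1 h.S_mem).1

/-- The invariant is preserved by a pass and the transition after it. -/
theorem next_good (hX : X.Nodup) (hL : IsALStream G L) (hm : MemGood ν G L X b m) :
    OutcomeGood ν G L X b (Mem.next ν (L.foldl Mem.step m)) := by
  obtain ⟨hbase, hph⟩ := hm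
  obtain ⟨X', b', S, ph⟩ := m
  cases ph with
  | start => exact hph.elim
  | count r =>
    obtain rfl : r = ⟨fun _ => 0, none⟩ := hph
    rw [show L.foldl Mem.step _ = _ from foldl_step_count L ⟨X', b', S, .start⟩ _]
    refine query_good ⟨hbase.1, hbase.2, hbase.3⟩ ⟨?_, nil_mem_dictSubsets _ _,
      nil_mem_dictPicks _ _⟩
    obtain ⟨h1, h2, h3, h4⟩ := count_result hbase hL
    exact ⟨h1, h2, h3, h4⟩
  | pick T r =>
    obtain ⟨hT, rfl⟩ := hph
    obtain ⟨Z, h1, -, -, -, -, h6, h7⟩ := pick_result hbase hX hL hT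
    rw [show L.foldl Mem.step _ = _ from foldl_step_pick L ⟨X', b', S, .start⟩ _ _]
    refine consult_good ⟨hbase.1, hbase.2, hbase.3⟩ hX (hT.with_phase _) ?_ ?_ .init
    · exact h1 ▸ h6
    · exact h1 ▸ h7
  | ask T W s =>
    obtain ⟨hT, hW, hν, hs⟩ := hph
    rw [show L.foldl Mem.step _ = _ from foldl_step_ask L ⟨X', b', S, .start⟩ _ _ _]
    refine consult_good ⟨hbase.1, hbase.2, hbase.3⟩ hX (hT.with_phase _) hW hν ?_
    exact StreamAlg.Visits.foldl (r := []) (by rwa [List.append_nil])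
  | delete N k r =>
    obtain ⟨hN, -, c, hc, hck, hb, rfl⟩ := hph
    obtain ⟨VS, h1, -, h3⟩ := delete_result hL hN hc hck hb
    rw [show L.foldl Mem.step _ = _ from foldl_step_delete L ⟨X', b', S, .start⟩ _ _ _]
    rw [← h1] at h3
    exact query_good ⟨hbase.1, hbase.2, hbase.3⟩
      ⟨⟨h3.1, h3.2, h3.3, h3.4⟩, nil_mem_dictSubsets _ _, nil_mem_dictPicks _ _⟩

/-- Every state that is visited occurs in a pass that has begun with a good state. -/
theorem exists_good_of_visits {X : Finset (Fin n)} {ℓ : ℕ} (hL : IsALStream G L)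
    {s : (alg A ν n).State} {r : List (ALToken (Fin n))} (h : (alg A ν n).Visits (X, ℓ) L s r) :
    (s = ⟨X.sort (· ≤ ·), min ℓ X.card, [], .start⟩ ∧ r = []) ∨ ∃ m l, l ++ r = L ∧
      s = l.foldl Mem.step m ∧ MemGood ν G L (X.sort (· ≤ ·)) (min ℓ X.card) m := by
  have hX : (X.sort (· ≤ ·)).Nodup := X.sort_nodup _
  induction h with
  | init => exact Or.inl ⟨rfl, rfl⟩
  | @next s s' _ hs' ih =>
    refine Or.inr ⟨s', [], rfl, rfl, ?_⟩
    rcases ih with ⟨rfl, -⟩ | ⟨m, l, hl, rfl, hm⟩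
    · obtain rfl := Sum.inl.inj hs'
      exact query_good (m := (⟨X.sort (· ≤ ·), min ℓ X.card, [], .start⟩ : Mem A n))
        ⟨rfl, rfl, nil_mem_dictSubsets _ _⟩ (T := .check _) (nil_mem_dictSubsets _ _)
    · rw [List.append_nil] at hl
      subst hl
      have := next_good hX hL hm
      change Mem.next ν _ = _ at hs'
      rw [hs'] at this
      exact this
  | @step s t r _ ih =>
    rcases ih with ⟨-, h⟩ | ⟨m, l, hl, rfl, hm⟩
    · simp at h
    · exact Or.inr ⟨m, l ++ [t], by simpa using hl, by rw [List.foldl_append]; rfl, hm⟩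

end Transitions

end TwinBranching

/-! ### The number of passes -/

section Numbers

variable {κ : Type}

theorem length_dictSubsets_le {U : List κ} (hU : U.Nodup) (k : ℕ) :
    (dictSubsets k U).length ≤ 2 ^ U.length := by
  rw [← List.length_sublists]
  refine ((nodup_dictSubsets hU).subperm fun J hJ => ?_).length_le
  exact List.mem_sublists.2 (mem_dictSubsets.1 hJ).2

theorem length_dictPicks_le {ec : List (κ × ℕ)} {N : ℕ} (hN : 2 ≤ N) (hec : ec.length ≤ N)
    (k : ℕ) : (dictPicks k ec).length ≤ 2 * N ^ k := by
  have h := sum_dictPicks_le (g := fun _ => 1) (R := fun k => 2 * N ^ k - 1) (N := N)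
    (by simp) (fun k => by
      have h1 : 1 ≤ N ^ k := Nat.one_le_pow _ _ (by omega)
      have h2 : N * (2 * N ^ k - 1) = 2 * N ^ (k + 1) - N := by
        rw [Nat.mul_sub, pow_succ]
        congr 1 <;> ring
      have h3 : N * 1 ≤ N * N ^ k := Nat.mul_le_mul_left _ h1
      simp only [h2, pow_succ, Nat.mul_comm _ N] at h3 ⊢
      omega) k ec hec
  simp only [List.map_const', List.sum_replicate, smul_eq_mul, mul_one] at h
  omega

theorem length_dictPicks_le_succ {ec : List (κ × ℕ)} (hec : ec.length ≤ 1) (k : ℕ) :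
    (dictPicks k ec).length ≤ k + 1 := by
  have h := sum_dictPicks_le (g := fun _ => 1) (R := fun k => k + 1) (N := 1)
    (by simp) (fun k => by omega) k ec hec
  simpa using h

/-- The number of pairs of a subset and a multiset of twin classes that a search enumerates. -/
theorem sum_length_dictPicks_le {ν : ℕ} (hν : 1 ≤ ν) (ec : List (κ × ℕ))
    {κ' : Type} (Y : List κ') (hec : ec.length ≤ 2 ^ Y.length) :
    ((dictSubsets ν Y).map fun J => (dictPicks (ν - J.length) ec).length).sum ≤
      4 * ν * 2 ^ (ν * Y.length) := by
  rcases Nat.eq_zero_or_pos Y.length with h0 | h0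
  · rw [List.length_eq_zero_iff] at h0
    subst h0
    have h1 := length_dictPicks_le_succ (by simpa using hec) ν
    have h2 : dictSubsets ν ([] : List κ') = [[]] := by
      cases ν <;> simp [dictSubsets, dictPicks]
    rw [h2]
    simp
    omega
  · -- as `|Y| / N ≤ 1 / 2`, the subsets `J` contribute a geometric series
    have hN : 2 * Y.length ≤ 2 ^ Y.length := by
      obtain ⟨y, hy⟩ : ∃ y, Y.length = y + 1 := ⟨_, (Nat.succ_pred_eq_of_pos h0).symm⟩
      have := Nat.lt_two_pow_self (n := y)
      rw [hy, pow_succ]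
      omega
    generalize hNdef : 2 ^ Y.length = N at *
    have h := sum_dictPicks_le (g := fun k => 2 * N ^ k) (R := fun k => 4 * N ^ k)
      (N := Y.length) (by simp) (fun k => by
        have : 2 * Y.length * N ^ k ≤ N * N ^ k := Nat.mul_le_mul_right _ hN
        simp only [pow_succ]
        nlinarith) ν (Y.map fun u => (u, 1)) (by simp)
    calc _ ≤ ((dictSubsets ν Y).map fun J => 2 * N ^ (ν - J.length)).sum :=
          List.sum_le_sum fun J _ => length_dictPicks_le (by omega) hec _
      _ ≤ 4 * N ^ ν := h
      _ ≤ 4 * ν * N ^ ν := Nat.mul_le_mul_right _ (by omega)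
      _ = 4 * ν * 2 ^ (ν * Y.length) := by rw [← hNdef, ← pow_mul, Nat.mul_comm ν Y.length]

/-- The binomial theorem, with one factor for each element in or outside `S`. -/
theorem sum_dictSubsets_pow_le {U : List κ} [DecidableEq κ] (hU : U.Nodup) (b c : ℕ) :
    ((dictSubsets b U).map fun S => c ^ (U.length - S.length)).sum ≤ (c + 1) ^ U.length := by
  have h1 : ∀ U : List κ, ((U.sublists').map fun S => c ^ (U.length - S.length)).sum =
      (c + 1) ^ U.length := by
    intro U
    induction U with
    | nil => simp
    | cons a U ih =>
      have h2 : ∀ S ∈ U.sublists', c ^ ((a :: U).length - S.length) =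
          c * c ^ (U.length - S.length) := by
        intro S hS
        have := (List.mem_sublists'.1 hS).length_le
        rw [← pow_succ', List.length_cons]
        congr 1
        omega
      rw [List.sublists'_cons, List.map_append, List.sum_append, List.map_congr_left h2,
        List.sum_map_mul_left, List.map_map]
      simp only [Function.comp_def, List.length_cons, Nat.add_sub_add_right]
      rw [ih, pow_succ]
      ring
  rw [← h1]
  obtain ⟨D, hp, hs⟩ := (nodup_dictSubsets (k := b) hU).subperm (l₂ := U.sublists')
    fun S hS => List.mem_sublists'.2 (mem_dictSubsets.1 hS).2
  rw [← (hp.map _).sum_eq]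
  exact (hs.map _).sum_le_sum fun _ _ => Nat.zero_le _

end Numbers

namespace TwinBranching

variable {n : ℕ} {A : GraphOracle} {Q : GraphProperty} {ν p : ℕ} {G : SimpleGraph (Fin n)}
  {L : List (ALToken (Fin n))} {X : List (Fin n)} {b : ℕ} {m : Mem A n} {N : Node n}

/-- `Reaches ν L x p y`: from the outcome `x` of a transition between two passes, the algorithm gets
to the outcome `y` in `p` passes. -/
abbrev Reaches (ν : ℕ) (L : List (ALToken (Fin n))) (x : Mem A n ⊕ Bool) (p : ℕ)
    (y : Mem A n ⊕ Bool) : Prop :=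
  Passes (Mem.next ν) Mem.step L x p y

/-- The stream `L` belongs to the graph `G` with the vertex cover `X`, and the oracle decides the
property `Q` on graphs with at most `ν` vertices in at most `p` passes. -/
structure Setting (A : GraphOracle) (Q : GraphProperty) (ν p : ℕ) (G : SimpleGraph (Fin n))
    (X : List (Fin n)) (L : List (ALToken (Fin n))) : Prop where
  oracle : ∀ h ≤ ν, ∀ (H : SimpleGraph (Fin h)) (L : List (ALToken (Fin h))), IsALStream H L →
    ∃ (q : ℕ) (a : Bool), (A h).Run L ((A h).init ()) q a ∧ q ≤ p ∧ (a = true ↔ Q.Mem H)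
  cover : ∀ u v, G.Adj u v → u ∈ X ∨ v ∈ X
  nodup : X.Nodup
  stream : IsALStream G L

/-- The oracle finishes its run. -/
theorem consult_go (m : Mem A n) (T : Task n) {W : List (Fin n)} {s : (A W.length).State}
    {q : ℕ} {a : Bool} (h : (A W.length).Run (L.filterMap (restrictToken W)) s q a) :
    Reaches ν L (m.consult ν T W s) q (m.answer ν T a) := by
  induction h generalizing m with
  | @halt s b hs =>
    rw [Mem.consult, hs]
    exact .refl _
  | @pass s s' p b hs _ ih =>
    rw [Mem.consult, hs]
    refine .pass ?_
    have h1 : Mem.next ν (L.foldl Mem.step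
        ({ m with phase := .ask T W s' } : Mem A n)) =
        Mem.consult ν ({ m with
          phase := .ask T W
            ((L.filterMap (restrictToken W)).foldl (A W.length).step s') } : Mem A n) T W
          ((L.filterMap (restrictToken W)).foldl (A W.length).step s') := by
      rw [foldl_step_ask]
      rfl
    rw [h1]
    -- the answer of the oracle is treated independently of the phase in which it is given
    refine (ih _).trans (q := 0) ?_
    have h2 : ∀ ph : Phase A n, ({ m with phase := ph } : Mem A n).answer ν T b =
        m.answer ν T b := by
      intro ph
      cases T <;> cases b <;> rfl
    rw [h2]
    exact .refl _

/-- An oracle call, with the pass that prepares it. -/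
theorem query_go
    (I : Setting A Q ν p G X L) (h : MemBase X b m) {T : Task n} (hT : TaskGood ν G m T) :
    ∃ q ≤ 1 + p, ∃ a : Bool, Reaches ν L (.inl (m.query T)) q (m.answer ν T a) ∧
      (a = true ↔ Bad Q G X m.Y T.J T.I) := by
  obtain ⟨Z, h1, h2, h3, h4, h5, h6, h7⟩ := pick_result h I.nodup I.stream hT
  obtain ⟨q, a, hrun, hq, ha⟩ := I.oracle _ h7 _ _ (isALStream_filterMap I.stream h6)
  have hYX : m.Y ⊆ X := fun v hv => h.X_eq ▸ (List.mem_filter.1 hv).1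
  refine ⟨q + 1, by omega, a, .pass ?_, ?_⟩
  · have e1 : m.query T = ({ m with phase := .pick T ⟨(T.I, T.J), none⟩ } : Mem A n) := by
      cases T <;> rfl
    have e2 : Mem.next ν (L.foldl Mem.step (m.query T)) =
        Mem.consult ν ({ m with phase := .pick T (L.foldl (Reader.step m.Y
            (collectVertex (m.unavailable T))) ⟨(T.I, T.J), none⟩) } : Mem A n)
          T (Z ++ T.J) ((A _).init ()) := by
      rw [e1, foldl_step_pick, ← h1]
      cases T <;> rfl
    rw [e2]
    refine (consult_go _ _ hrun).trans (q := 0) ?_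
    have e3 : ∀ ph : Phase A n, ({ m with phase := ph } : Mem A n).answer ν T a =
        m.answer ν T a := by
      intro ph
      cases T <;> cases a <;> rfl
    rw [e3]
    exact .refl _
  · rw [ha, bad_iff I.cover (h.nodup_Y I.nodup) hYX h5 h2 h3 h4]

open Classical in
/-- The first multiset of classes that, together with `J`, induces a graph in the property. -/
noncomputable def firstPick (Q : GraphProperty) (ν : ℕ) (G : SimpleGraph (Fin n)) (m : Mem A n)
    (EC : Key n → ℕ) (J : List (Fin n)) : Option (List (Key n)) :=
  (dictPicks (ν - J.length) (m.classes EC)).find? fun I => Bad Q G m.X m.Y J I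

/-- The multiset of classes that a search with the class sizes `EC` finds. -/
noncomputable def firstBad (Q : GraphProperty) (ν : ℕ) (G : SimpleGraph (Fin n)) (m : Mem A n)
    (EC : Key n → ℕ) : Option (List (Key n)) :=
  ((dictSubsets ν m.Y).find? fun J => (firstPick Q ν G m EC J).isSome).elim none
    (firstPick Q ν G m EC)

theorem firstBad_eq_some {EC : Key n → ℕ} {I : List (Key n)} (h : firstBad Q ν G m EC = some I) :
    ∃ J ∈ dictSubsets ν m.Y, I ∈ dictPicks (ν - J.length) (m.classes EC) ∧
      Bad Q G m.X m.Y J I := by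
  unfold firstBad at h
  cases hJ : (dictSubsets ν m.Y).find? fun J => (firstPick Q ν G m EC J).isSome with
  | none => simp [hJ] at h
  | some J =>
    rw [hJ] at h
    have h : firstPick Q ν G m EC J = some I := h
    exact ⟨J, List.mem_of_find?_eq_some hJ, List.mem_of_find?_eq_some h,
      by simpa using List.find?_some h⟩

theorem freeProfile_of_firstBad_eq_none (hY : m.Y.Nodup) {EC : Key n → ℕ}
    (h : firstBad Q ν G m EC = none) : FreeProfile Q ν G m.X m.Y EC := by
  have h1 : ∀ J ∈ dictSubsets ν m.Y, firstPick Q ν G m EC J = none := by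
    unfold firstBad at h
    cases hJ : (dictSubsets ν m.Y).find? fun J => (firstPick Q ν G m EC J).isSome with
    | none => simpa using hJ
    | some J =>
      rw [hJ] at h
      have h2 := List.find?_some hJ
      have h : firstPick Q ν G m EC J = none := h
      simp [h] at h2
  intro J I hJ hν hI hbad
  have h2 := h1 J (mem_dictSubsets.2 ⟨by omega, hJ⟩)
  obtain ⟨I', hI', hp⟩ := exists_perm_mem_dictPicks (m := m) hY (j := ν - J.length) (I := I)
    (EC := EC) (by omega) (fun k hk => by
      obtain ⟨v, rfl⟩ := hbad.exists_classOf_eq hk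
      exact ⟨classOf_sublist _ _ _, hI _⟩)
  unfold firstPick at h2
  rw [List.find?_eq_none] at h2
  obtain ⟨Z, h3, h4, h5, h6⟩ := hbad
  exact h2 I' hI' (by simpa using ⟨Z, h3, h4, h5.trans hp.symm, h6⟩)

end TwinBranching

/-! ### The search tree -/

namespace TwinBranching

variable {n : ℕ} {A : GraphOracle} {Q : GraphProperty} {ν p : ℕ} {G : SimpleGraph (Fin n)}
  {L : List (ALToken (Fin n))} {X : List (Fin n)} {b : ℕ} {m : Mem A n} {N : Node n}

/-- A bound on the number of passes for the enumeration of all subsets and multisets at a node,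
if `y` vertices of the vertex cover are not deleted. -/
def scanCost (ν p y : ℕ) : ℕ := 4 * ν * 2 ^ (ν * y) * (1 + p)

theorem length_classes_le (hY : m.Y.Nodup) (EC : Key n → ℕ) :
    (m.classes EC).length ≤ 2 ^ m.Y.length := by
  simpa [Mem.classes] using length_dictSubsets_le hY m.Y.length

/-- The enumeration at a node, from its beginning to the first hit. As the hit depends on the class
sizes only, it is found again on return from a child of the node. -/
theorem scan_go (hs : Setting A Q ν p G X L) (h : MemBase X b m) (hν : 1 ≤ ν)
    (hN : NodeGood G m N) : ∃ q ≤ scanCost ν p m.Y.length,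
      Reaches ν L (.inl (m.query (.search N [] []))) q
        ((firstBad Q ν G m N.EC).elim (.inr true) (m.branch N)) := by
  classical
  have hY := h.nodup_Y hs.nodup
  have hinner : ∀ J ∈ dictSubsets ν m.Y,
      ∃ q ≤ (dictPicks (ν - J.length) (m.classes N.EC)).length * (1 + p),
      Reaches ν L (.inl (m.query (.search N J []))) q
        ((firstPick Q ν G m N.EC J).elim
          ((dictNext (dictSubsets ν m.Y) J).elim (.inr true)
            fun J' => .inl (m.query (.search N J' []))) (m.branch N)) := by
    intro J hJ
    obtain ⟨q, hq, hgo⟩ := Passes.exists_passes_find (next := Mem.next ν)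
      (step := Mem.step (A := A)) (L := L)
      (D := dictPicks (ν - J.length) (m.classes N.EC)) (nodup_dictPicks (nodup_classes hY))
      (f := fun I => .inl (m.query (.search N J I))) (g := m.branch N)
      (e := (dictNext (dictSubsets ν m.Y) J).elim (.inr true)
        fun J' => .inl (m.query (.search N J' [])))
      (hit := fun I => Bad Q G m.X m.Y J I) (c := fun _ => 1 + p)
      (fun I hI => by
        obtain ⟨q, hq, a, hgo, ha⟩ := query_go hs h (T := .search N J I) ⟨hN, hJ, hI⟩
        refine ⟨q, hq, ?_⟩
        rw [← h.X_eq] at ha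
        change a = true ↔ Bad Q G m.X m.Y J I at ha
        cases a with
        | true =>
          rw [if_pos (decide_eq_true (ha.1 rfl))]
          exact hgo
        | false =>
          have hnb : ¬ Bad Q G m.X m.Y J I := fun hb => Bool.noConfusion (ha.2 hb)
          simp only [hnb, decide_false, Bool.false_eq_true, if_false]
          refine hgo.trans (q := 0) ?_
          simp only [Mem.answer]
          cases dictNext (dictPicks (ν - J.length) (m.classes N.EC)) I <;>
            cases dictNext (dictSubsets ν m.Y) J <;> exact .refl _)
      (a₀ := []) (by obtain ⟨t, ht⟩ := dictPicks_eq_cons (ν - J.length) (m.classes N.EC); simp [ht])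
    exact ⟨q, by simpa using hq, hgo⟩
  obtain ⟨q, hq, hgo⟩ := Passes.exists_passes_find (next := Mem.next ν)
      (step := Mem.step (A := A)) (L := L)
    (D := dictSubsets ν m.Y) (nodup_dictSubsets hY)
    (f := fun J => .inl (m.query (.search N J [])))
    (g := fun J => (firstPick Q ν G m N.EC J).elim (.inr true) (m.branch N)) (e := .inr true)
    (hit := fun J => (firstPick Q ν G m N.EC J).isSome)
    (c := fun J => (dictPicks (ν - J.length) (m.classes N.EC)).length * (1 + p))
    (fun J hJ => by
      obtain ⟨q, hq, hgo⟩ := hinner J hJ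
      refine ⟨q, hq, ?_⟩
      cases hI : firstPick Q ν G m N.EC J with
      | none => simpa [hI] using hgo
      | some I => simpa [hI] using hgo)
    (a₀ := []) (by obtain ⟨t, ht⟩ := dictPicks_eq_cons ν (m.Y.map fun u => (u, 1));
                   simp [dictSubsets, ht])
  refine ⟨q, hq.trans ?_, ?_⟩
  · rw [List.sum_map_mul_right]
    exact Nat.mul_le_mul_right _ (sum_length_dictPicks_le hν _ _ (length_classes_le hY _))
  · unfold firstBad
    cases hJ : (dictSubsets ν m.Y).find? fun J => (firstPick Q ν G m N.EC J).isSome with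
    | none => simpa [hJ] using hgo
    | some J => simpa [hJ] using hgo

/-- The pass in which the vertices are deleted that cut down the class `k` at a branching. -/
theorem delete_go (hs : Setting A Q ν p G X L) (hN : NodeGood G m N) {k : Key n} {c : ℕ}
    (hc : 1 ≤ c) (hck : c ≤ N.EC k) (hb : m.S.length + N.deleted.length + c ≤ m.budget) :
    ∃ VS : List (Fin n), VS.length = c ∧
      NodeGood G m ⟨Function.update N.EC k (N.EC k - VS.length), (k, VS) :: N.stack, none⟩ ∧
      Reaches ν L (.inl ({ m with
        phase := .delete N k ⟨(List.replicate c k, []), none⟩ } : Mem A n)) 1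
        (.inl (m.query (.search
          ⟨Function.update N.EC k (N.EC k - VS.length), (k, VS) :: N.stack, none⟩ [] []))) := by
  obtain ⟨VS, h1, h2, h3⟩ := delete_result hs.stream hN hc hck hb
  refine ⟨VS, h2, h3, .pass ?_⟩
  rw [foldl_step_delete]
  subst h1
  exact .refl _

/-- The number of deletions at a node. -/
def nodeSize (m : Mem A n) (N : Node n) : ℕ := m.S.length + N.deleted.length

/-- The outcome of a branching for which the classes in `todo` are still to be tried. -/
def tryClasses (m : Mem A n) (N : Node n) (I todo : List (Key n)) : Mem A n ⊕ Bool :=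
  match todo.find? fun k => nodeSize m N + (N.EC k - (I.count k - 1)) ≤ m.budget with
  | none => m.fail N
  | some k => .inl { m with
      phase := .delete N k ⟨(List.replicate (N.EC k - (I.count k - 1)) k, []), none⟩ }

theorem branch_of_resume_none {EC : Key n → ℕ} {stack : List (Key n × List (Fin n))}
    {I : List (Key n)} (hb : nodeSize m ⟨EC, stack, none⟩ < m.budget) :
    m.branch ⟨EC, stack, none⟩ I = tryClasses m ⟨EC, stack, none⟩ I I.dedup := by
  unfold Mem.branch
  exact if_neg (not_le.2 hb)

/-- On return from the child for the class `k`, exactly the classes after `k` are still to be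
tried. -/
theorem branch_of_resume_some {EC : Key n → ℕ} {stack : List (Key n × List (Fin n))}
    {I pre post : List (Key n)} {k : Key n} (hb : nodeSize m ⟨EC, stack, some k⟩ < m.budget)
    (hI : I.dedup = pre ++ k :: post) :
    m.branch ⟨EC, stack, some k⟩ I = tryClasses m ⟨EC, stack, some k⟩ I post := by
  have hk : k ∉ pre := by
    have := I.nodup_dedup
    rw [hI, List.nodup_append'] at this
    exact fun h => this.2.2 h (by simp)
  have hd : I.dedup.drop (I.dedup.idxOf k + 1) = post := by
    rw [hI, List.idxOf_append_of_notMem hk, List.idxOf_cons_self, Nat.add_zero]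
    simp
  unfold Mem.branch
  refine (if_neg (not_le.2 hb)).trans ?_
  simp only [hd]
  rfl

theorem tryClasses_cons_of_le {I todo : List (Key n)} {k : Key n}
    (hk : nodeSize m N + (N.EC k - (I.count k - 1)) ≤ m.budget) :
    tryClasses m N I (k :: todo) = .inl ({ m with
      phase := .delete N k
        ⟨(List.replicate (N.EC k - (I.count k - 1)) k, []), none⟩ } : Mem A n) := by
  simp [tryClasses, hk]

theorem tryClasses_cons_of_not_le {I todo : List (Key n)} {k : Key n}
    (hk : ¬ nodeSize m N + (N.EC k - (I.count k - 1)) ≤ m.budget) :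
    tryClasses m N I (k :: todo) = tryClasses m N I todo := by
  simp only [tryClasses, List.find?_cons_of_neg (p := fun k => decide
    (nodeSize m N + (N.EC k - (I.count k - 1)) ≤ m.budget)) (by simpa using hk)]

/-- What follows the answer NO at a node does not depend on the children that have been tried. -/
theorem fail_congr {N' : Node n} (h1 : N'.EC = N.EC) (h2 : N'.stack = N.stack) :
    m.fail N' = m.fail N := by
  unfold Mem.fail
  rw [h1, h2]

/-- One enumeration at a node, and for each of the `l` children a deletion, a search and another
enumeration. -/
theorem search_cost_step {B ν a l : ℕ} (hB : 1 ≤ B) (ha : 1 ≤ a) (hl : l ≤ ν) (hν : 1 ≤ ν) :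
    B + l * (1 + 3 * B * a + B) ≤ 3 * B * (a * (2 * ν)) := by
  have h1 : l * (1 + 3 * B * a + B) ≤ ν * (1 + 3 * B * a + B) := Nat.mul_le_mul_right _ hl
  have h2 : 1 ≤ B * a := Nat.mul_le_mul hB ha
  have h3 : B * 1 ≤ B * a := Nat.mul_le_mul_left _ ha
  have h4 : 1 * (B * a) ≤ ν * (B * a) := Nat.mul_le_mul_right _ hν
  have h5 : ν * (1 + B) ≤ ν * (2 * (B * a)) := Nat.mul_le_mul_left _ (by omega)
  nlinarith

/-- The search at a node answers YES if and only if the node is solvable; otherwise it returns to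
the parent. A node with `d` remaining deletions has at most `ν` children, each with fewer
remaining deletions, and each child is followed by another enumeration at the node. -/
theorem search_go (hs : Setting A Q ν p G X L) (h : MemBase X b m) (hν : 1 ≤ ν) (d : ℕ) :
    ∀ (EC : Key n → ℕ) (stack : List (Key n × List (Fin n))),
    NodeGood G m ⟨EC, stack, none⟩ → m.budget ≤ nodeSize m ⟨EC, stack, none⟩ + d →
    ∃ q ≤ 3 * scanCost ν p m.Y.length * (2 * ν) ^ d, ∃ y,
      Reaches ν L (.inl (m.query (.search ⟨EC, stack, none⟩ [] []))) q y ∧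
      (Solvable Q ν G X m.Y m.budget (nodeSize m ⟨EC, stack, none⟩) EC → y = .inr true) ∧
      (¬ Solvable Q ν G X m.Y m.budget (nodeSize m ⟨EC, stack, none⟩) EC →
        y = m.fail ⟨EC, stack, none⟩) := by
  have hB1 : 1 ≤ scanCost ν p m.Y.length := by
    unfold scanCost
    have : 1 ≤ 2 ^ (ν * m.Y.length) := Nat.one_le_two_pow
    have h1 := Nat.mul_le_mul (Nat.mul_le_mul (show 1 ≤ 4 * ν by omega) this)
      (show 1 ≤ 1 + p by omega)
    simpa using h1
  have hY := h.nodup_Y hs.nodup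
  have hXe := h.X_eq
  induction d with
  | zero =>
    intro EC stack hN hd
    obtain ⟨q, hq, hgo⟩ := scan_go hs h hν hN
    refine ⟨q, by rw [pow_zero]; omega, _, hgo, ?_⟩
    cases hf : firstBad Q ν G m EC with
    | none =>
      have hfree := freeProfile_of_firstBad_eq_none hY hf
      rw [hXe] at hfree
      exact ⟨fun _ => rfl, fun hn => absurd (Solvable.of_free hfree hN.size_le) hn⟩
    | some I =>
      obtain ⟨J, hJ, hI, hbad⟩ := firstBad_eq_some hf
      have hJ' := mem_dictSubsets.1 hJ
      rw [hXe] at hbad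
      have hcount := count_le_of_mem_dictPicks hY hI
      have h1 := (mem_dictPicks.1 hI).1
      have hfail : m.branch ⟨EC, stack, none⟩ I = m.fail ⟨EC, stack, none⟩ := by
        unfold Mem.branch
        exact if_pos hd
      refine ⟨fun hsol => ?_, fun _ => hfail⟩
      rw [solvable_iff_of_bad hJ'.2 (by omega) hcount hbad] at hsol
      obtain ⟨k, hk, hle, -⟩ := hsol
      have := hcount k
      have := List.count_pos_iff.2 hk
      omega
  | succ d ih =>
    intro EC stack hN hd
    obtain ⟨q, hq, hgo⟩ := scan_go hs h hν hN
    cases hf : firstBad Q ν G m EC with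
    | none =>
      have hfree := freeProfile_of_firstBad_eq_none hY hf
      rw [hXe] at hfree
      simp only [hf, Option.elim_none] at hgo
      refine ⟨q, hq.trans ?_, _, hgo, fun _ => rfl,
        fun hn => absurd (Solvable.of_free hfree hN.size_le) hn⟩
      have : 1 ≤ (2 * ν) ^ (d + 1) := Nat.one_le_pow _ _ (by omega)
      nlinarith
    | some I =>
      obtain ⟨J, hJ, hI, hbad⟩ := firstBad_eq_some hf
      have hJ' := mem_dictSubsets.1 hJ
      rw [hXe] at hbad
      have hcount := count_le_of_mem_dictPicks hY hI
      have h1 := (mem_dictPicks.1 hI).1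
      have hIν : J.length + I.length ≤ ν := by omega
      simp only [hf, Option.elim_some] at hgo
      rw [solvable_iff_of_bad hJ'.2 hIν hcount hbad]
      have ha : 1 ≤ (2 * ν) ^ d := Nat.one_le_pow _ _ (by omega)
      rcases le_or_gt m.budget (nodeSize m ⟨EC, stack, none⟩) with hle | hlt
      · have hfail : m.branch ⟨EC, stack, none⟩ I = m.fail ⟨EC, stack, none⟩ := by
          unfold Mem.branch
          exact if_pos hle
        rw [hfail] at hgo
        refine ⟨q, hq.trans ?_, _, hgo, fun hsol => ?_, fun _ => rfl⟩
        · have : 1 ≤ (2 * ν) ^ (d + 1) := Nat.one_le_pow _ _ (by omega)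
          nlinarith
        · obtain ⟨k, hk, hle', -⟩ := hsol
          have := hcount k
          have := List.count_pos_iff.2 hk
          omega
      · rw [branch_of_resume_none hlt] at hgo
        -- the class `k` leads to a child, and this child is solvable
        let child : Key n → Prop := fun k =>
          nodeSize m ⟨EC, stack, none⟩ + (EC k - (I.count k - 1)) ≤ m.budget ∧
            Solvable Q ν G X m.Y m.budget
              (nodeSize m ⟨EC, stack, none⟩ + (EC k - (I.count k - 1)))
              (Function.update EC k (EC k - (EC k - (I.count k - 1))))
        have loop : ∀ (todo pre : List (Key n)) (res : Option (Key n)),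
            I.dedup = pre ++ todo → (∀ k ∈ res, k.Sublist m.Y) →
            ∃ q ≤ todo.length * (1 + 3 * scanCost ν p m.Y.length * (2 * ν) ^ d +
                scanCost ν p m.Y.length), ∃ y,
              Reaches ν L (tryClasses m ⟨EC, stack, res⟩ I todo) q y ∧
              ((∃ k ∈ todo, child k) → y = .inr true) ∧
              ((¬ ∃ k ∈ todo, child k) → y = m.fail ⟨EC, stack, none⟩) := by
          intro todo
          induction todo with
          | nil =>
            intro pre res _ _
            exact ⟨0, Nat.zero_le _, _, .refl _, by simp, fun _ => fail_congr rfl rfl⟩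
          | cons k todo iht =>
            intro pre res hpre hres
            have hpre' : I.dedup = (pre ++ [k]) ++ todo := by simpa using hpre
            have hkI : k ∈ I := List.mem_dedup.1 (by rw [hpre]; simp)
            have hkpos := List.count_pos_iff.2 hkI
            have hkc := hcount k
            by_cases hk : nodeSize m ⟨EC, stack, none⟩ + (EC k - (I.count k - 1)) ≤ m.budget
            · have htry := tryClasses_cons_of_le (N := ⟨EC, stack, res⟩) (todo := todo) hk
              have hNr : NodeGood G m ⟨EC, stack, res⟩ := ⟨hN.1, hN.2, hN.3, hres⟩
              obtain ⟨VS, hVS, hchild, hgo1⟩ := delete_go (ν := ν) hs hNr (k := k)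
                (c := EC k - (I.count k - 1)) (by omega) (Nat.sub_le _ _) hk
              have hsize : nodeSize m ⟨Function.update EC k (EC k - VS.length),
                  (k, VS) :: stack, none⟩ =
                  nodeSize m ⟨EC, stack, none⟩ + (EC k - (I.count k - 1)) := by
                simp only [nodeSize, Node.deleted, List.flatMap_cons, List.length_append, hVS]
                omega
              obtain ⟨q2, hq2, y, hgo2, hy1, hy2⟩ := ih _ _ hchild (by rw [hsize]; omega)
              rw [hsize, hVS] at hy1
              replace hy2 := fun hn => hy2 (by rw [hsize, hVS]; exact hn)
              rw [htry]
              by_cases hsol : Solvable Q ν G X m.Y m.budget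
                  (nodeSize m ⟨EC, stack, none⟩ + (EC k - (I.count k - 1)))
                  (Function.update EC k (EC k - (EC k - (I.count k - 1))))
              · refine ⟨1 + q2, ?_, y, hgo1.trans hgo2, fun _ => hy1 hsol, fun hn =>
                  absurd ⟨k, List.mem_cons_self, hk, hsol⟩ hn⟩
                rw [List.length_cons, Nat.add_mul]
                omega
              · obtain rfl := hy2 hsol
                have hparent := hchild.parent
                have hEC : Function.update (Function.update EC k (EC k - VS.length)) k
                    (Function.update EC k (EC k - VS.length) k + VS.length) = EC := by
                  rw [Function.update_self, Function.update_idem]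
                  have : EC k - VS.length + VS.length = EC k := by omega
                  rw [this, Function.update_eq_self]
                simp only [hEC] at hparent
                have hfail : m.fail ⟨Function.update EC k (EC k - VS.length),
                    (k, VS) :: stack, none⟩ =
                    .inl (m.query (.search ⟨EC, stack, some k⟩ [] [])) := by
                  unfold Mem.fail
                  simp only
                  rw [hEC]
                rw [hfail] at hgo2
                obtain ⟨q3, hq3, hgo3⟩ := scan_go hs h hν hparent
                simp only [hf, Option.elim_some] at hgo3
                rw [branch_of_resume_some hlt hpre] at hgo3
                obtain ⟨q4, hq4, y, hgo4, hy3, hy4⟩ := iht (pre ++ [k]) (some k) hpre'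
                  hparent.resume
                refine ⟨1 + q2 + q3 + q4, ?_, y,
                  ((hgo1.trans hgo2).trans hgo3).trans hgo4, ?_, ?_⟩
                · rw [List.length_cons, Nat.add_mul]
                  omega
                · rintro ⟨k', hk', h3, h4⟩
                  rcases List.mem_cons.1 hk' with rfl | hk'
                  · exact absurd h4 hsol
                  · exact hy3 ⟨k', hk', h3, h4⟩
                · exact fun hn => hy4 fun ⟨k', hk', h3⟩ =>
                    hn ⟨k', List.mem_cons_of_mem _ hk', h3⟩
            · have htry := tryClasses_cons_of_not_le (N := ⟨EC, stack, res⟩) (todo := todo) hk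
              obtain ⟨q4, hq4, y, hgo4, hy3, hy4⟩ := iht (pre ++ [k]) res hpre' hres
              rw [htry]
              refine ⟨q4, ?_, y, hgo4, ?_, ?_⟩
              · rw [List.length_cons, Nat.add_mul]
                omega
              · rintro ⟨k', hk', h3, h4⟩
                rcases List.mem_cons.1 hk' with rfl | hk'
                · exact absurd h3 hk
                · exact hy3 ⟨k', hk', h3, h4⟩
              · exact fun hn => hy4 fun ⟨k', hk', h3⟩ =>
                  hn ⟨k', List.mem_cons_of_mem _ hk', h3⟩
        obtain ⟨q', hq', y, hgo', hy1, hy2⟩ := loop I.dedup [] none rfl (by simp)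
        refine ⟨q + q', ?_, y, hgo.trans hgo', ?_, ?_⟩
        · have hl : I.dedup.length ≤ ν := (I.dedup_sublist.length_le).trans (by omega)
          rw [pow_succ]
          have := search_cost_step hB1 ha hl hν
          omega
        · simpa only [List.mem_dedup] using hy1
        · simpa only [List.mem_dedup] using hy2

end TwinBranching

/-! ### The loop over the deleted parts of the vertex cover -/

namespace TwinBranching

variable {n : ℕ} {A : GraphOracle} {Q : GraphProperty} {ν p : ℕ} {G : SimpleGraph (Fin n)}
  {L : List (ALToken (Fin n))} {X : List (Fin n)} {b : ℕ} {m : Mem A n}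

theorem MemBase.length_Y (h : MemBase X b m) (hX : X.Nodup) :
    m.Y.length = X.length - m.S.length := by
  have hS := (mem_dictSubsets.1 h.S_mem).2
  have h1 : (X.filter fun x => x ∈ m.S).length = m.S.length := by
    rw [← List.toFinset_card_of_nodup (hX.filter _),
      ← List.toFinset_card_of_nodup (hX.sublist hS)]
    congr 1
    ext v
    simpa using fun hv => hS.subset hv
  have h2 := List.length_eq_length_filter_add (l := X) fun x => decide (x ∈ m.S)
  have h3 : m.Y = X.filter fun x => !decide (x ∈ m.S) := by
    rw [Mem.Y, h.X_eq]
    exact List.filter_congr fun x _ => by simp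
  rw [h3]
  omega

/-- The computation for one deleted part `S` of the vertex cover. -/
theorem cover_go (hs : Setting A Q ν p G X L) (h : MemBase X b m) (hν : 1 ≤ ν)
    (hb : b ≤ X.length) :
    ∃ q ≤ 5 * scanCost ν p m.Y.length * (2 * ν) ^ m.Y.length, ∃ y,
      Reaches ν L (.inl (m.query (.check []))) q y ∧
      (Solvable Q ν G X m.Y m.budget m.S.length (classSize G X m.Y []) → y = .inr true) ∧
      (¬ Solvable Q ν G X m.Y m.budget m.S.length (classSize G X m.Y []) →
        y = m.nextCover) := by
  classical
  have hY := h.nodup_Y hs.nodup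
  have hpow : 1 ≤ (2 * ν) ^ m.Y.length := Nat.one_le_pow _ _ (by omega)
  obtain ⟨q, hq, hgo⟩ := Passes.exists_passes_find (next := Mem.next ν)
    (step := Mem.step (A := A)) (L := L) (D := dictSubsets ν m.Y) (nodup_dictSubsets hY)
    (f := fun J => .inl (m.query (.check J))) (g := fun _ => m.nextCover)
    (e := .inl { m with phase := .count ⟨fun _ => 0, none⟩ })
    (hit := fun J => Bad Q G X m.Y J []) (c := fun _ => 1 + p)
    (fun J hJ => by
      obtain ⟨q, hq, a, hgo, ha⟩ := query_go hs h (T := .check J) hJ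
      refine ⟨q, hq, ?_⟩
      change a = true ↔ Bad Q G X m.Y J [] at ha
      cases a with
      | true =>
        rw [if_pos (decide_eq_true (ha.1 rfl))]
        exact hgo
      | false =>
        have hnb : ¬ Bad Q G X m.Y J [] := fun hb => Bool.noConfusion (ha.2 hb)
        simp only [hnb, decide_false, Bool.false_eq_true, if_false]
        refine hgo.trans (q := 0) ?_
        simp only [Mem.answer]
        cases dictNext (dictSubsets ν m.Y) J <;> exact .refl _)
    (a₀ := []) (by obtain ⟨t, ht⟩ := dictPicks_eq_cons ν (m.Y.map fun u => (u, 1));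
                   simp [dictSubsets, ht])
  have hq' : q ≤ scanCost ν p m.Y.length := by
    refine hq.trans ?_
    have h1 := sum_length_dictPicks_le hν (m.classes fun _ => 0) m.Y (length_classes_le hY _)
    have h2 : ((dictSubsets ν m.Y).map fun _ => 1 + p).sum ≤ ((dictSubsets ν m.Y).map fun J =>
        (dictPicks (ν - J.length) (m.classes fun _ => 0)).length * (1 + p)).sum := by
      refine List.sum_le_sum fun J _ => Nat.le_mul_of_pos_left _ ?_
      exact List.length_pos_of_mem (nil_mem_dictPicks _ _)
    rw [List.sum_map_mul_right] at h2
    exact h2.trans (Nat.mul_le_mul_right _ h1)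
  have hB1 : 1 ≤ scanCost ν p m.Y.length := by
    unfold scanCost
    have h1 : 0 < 2 ^ (ν * m.Y.length) := by positivity
    have h2 : 0 < 4 * ν := by omega
    have h3 : 0 < 1 + p := by omega
    exact Nat.mul_pos (Nat.mul_pos h2 h1) h3
  cases hJ : (dictSubsets ν m.Y).find? fun J => Bad Q G X m.Y J [] with
  | some J =>
    have h1 : Bad Q G X m.Y J [] := by simpa using List.find?_some hJ
    have h2 := mem_dictSubsets.1 (List.mem_of_find?_eq_some hJ)
    rw [hJ] at hgo
    refine ⟨q, hq'.trans ?_, _, hgo, fun hsol => absurd h1 (hsol.not_bad_nil h2.2 h2.1),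
      fun _ => rfl⟩
    nlinarith
  | none =>
    rw [hJ] at hgo
    have hN := count_result h hs.stream
    have hpass : Reaches ν L (.inl ({ m with phase := .count ⟨fun _ => 0, none⟩ } : Mem A n)) 1
        (.inl (m.query (.search ⟨(L.foldl (Reader.step m.Y (countVertex m.X))
          ⟨fun _ => 0, none⟩).flush m.Y (countVertex m.X), [], none⟩ [] []))) := by
      refine .pass ?_
      rw [foldl_step_count]
      exact .refl _
    have hEC := hN.sizes
    change _ = classSize G m.X m.Y [] at hEC
    simp only at hEC
    rw [hEC] at hN hpass
    have hsize : nodeSize m ⟨classSize G m.X m.Y [], [], none⟩ = m.S.length := rfl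
    obtain ⟨q2, hq2, y, hgo2, hy1, hy2⟩ := search_go hs h hν m.Y.length _ _ hN (by
      rw [hsize, h.length_Y hs.nodup, h.budget_eq]
      omega)
    rw [hsize, h.X_eq] at hy1 hy2
    refine ⟨q + 1 + q2, ?_, y, (hgo.trans hpass).trans hgo2, hy1, hy2⟩
    have h3 : 1 * scanCost ν p m.Y.length ≤ (2 * ν) ^ m.Y.length * scanCost ν p m.Y.length :=
      Nat.mul_le_mul_right _ hpow
    nlinarith

theorem sum_cover_cost_le (hν : 1 ≤ ν) (hX : X.Nodup) :
    ((dictSubsets b X).map fun S => 5 * scanCost ν p (X.length - S.length) *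
      (2 * ν) ^ (X.length - S.length)).sum ≤
      20 * (3 ^ X.length * ν ^ (X.length + 1) * 2 ^ (ν * X.length) * (1 + p)) := by
  have h1 : ∀ y, 5 * scanCost ν p y * (2 * ν) ^ y =
      20 * ν * (1 + p) * (2 * ν * 2 ^ ν) ^ y := by
    intro y
    rw [scanCost, mul_pow (2 * ν) (2 ^ ν), ← pow_mul]
    ring
  simp only [h1]
  rw [List.sum_map_mul_left]
  have h2 : 2 * ν * 2 ^ ν + 1 ≤ 3 * ν * 2 ^ ν := by
    have : 1 * 1 ≤ ν * 2 ^ ν := Nat.mul_le_mul hν Nat.one_le_two_pow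
    nlinarith
  calc _ ≤ 20 * ν * (1 + p) * (3 * ν * 2 ^ ν) ^ X.length := by
        refine Nat.mul_le_mul_left _ ((sum_dictSubsets_pow_le hX b _).trans ?_)
        exact Nat.pow_le_pow_left h2 _
    _ = _ := by
        rw [mul_pow, mul_pow, ← pow_mul]
        ring

/-- The run of the algorithm: its length and its answer. -/
theorem alg_run {X : Finset (Fin n)} (hs : Setting A Q ν p G (X.sort (· ≤ ·)) L) (hν : 1 ≤ ν)
    (hQ : ∀ (h : ℕ) (H : SimpleGraph (Fin h)), Q.Mem H → h ≤ ν) (ℓ : ℕ) :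
    ∃ (q : ℕ) (a : Bool), (alg A ν n).Run L ((alg A ν n).init (X, ℓ)) q a ∧
      q ≤ 20 * (3 ^ X.card * ν ^ (X.card + 1) * 2 ^ (ν * X.card) * (1 + p)) ∧
      (a = true ↔ Q.Deletable G (min ℓ X.card)) := by
  classical
  set Xs := X.sort (· ≤ ·) with hXs
  have hlen : Xs.length = X.card := X.length_sort _
  set b := min ℓ X.card with hb
  let m : Mem A n := ⟨Xs, b, [], .start⟩
  have hbase : ∀ S ∈ dictSubsets b Xs, MemBase Xs b { m with S := S } :=
    fun S hS => ⟨rfl, rfl, hS⟩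
  obtain ⟨q, hq, hgo⟩ := Passes.exists_passes_find (next := Mem.next ν)
    (step := Mem.step (A := A)) (L := L) (D := dictSubsets b Xs) (nodup_dictSubsets hs.nodup)
    (f := fun S => .inl (({ m with S := S } : Mem A n).query (.check [])))
    (g := fun _ => .inr true) (e := .inr false)
    (hit := fun S => Solvable Q ν G Xs (Xs.filter fun x => x ∉ S) b S.length
      (classSize G Xs (Xs.filter fun x => x ∉ S) []))
    (c := fun S => 5 * scanCost ν p (Xs.length - S.length) * (2 * ν) ^ (Xs.length - S.length))
    (fun S hS => by
      obtain ⟨q, hq, y, hgo, hy1, hy2⟩ := cover_go hs (hbase S hS) hν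
        (by rw [hlen]; exact min_le_right _ _)
      rw [(hbase S hS).length_Y hs.nodup] at hq
      refine ⟨q, hq, ?_⟩
      by_cases hsol : Solvable Q ν G Xs (Xs.filter fun x => x ∉ S) b S.length
        (classSize G Xs (Xs.filter fun x => x ∉ S) [])
      · rw [if_pos (decide_eq_true hsol)]
        exact hy1 hsol ▸ hgo
      · rw [if_neg (by simpa using hsol)]
        have h1 := hy2 hsol
        subst h1
        refine hgo.trans (q := 0) ?_
        unfold Mem.nextCover
        change Passes _ _ _ (match dictNext (dictSubsets b Xs) S with
          | some S' => _
          | none => _) _ _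
        cases dictNext (dictSubsets b Xs) S <;> exact .refl _)
    (a₀ := []) (by obtain ⟨t, ht⟩ := dictPicks_eq_cons b (Xs.map fun u => (u, 1));
                   simp [dictSubsets, ht])
  rw [deletable_iff hQ hs.cover hs.nodup, ← hlen]
  refine ⟨q, _, Passes.run (A := alg A ν n) (p := q)
    (b := ((dictSubsets b Xs).find? fun S => decide (Solvable Q ν G Xs (Xs.filter fun x => x ∉ S)
      b S.length (classSize G Xs (Xs.filter fun x => x ∉ S) []))).isSome) (x := .inl
      (({ m with S := [] } : Mem A n).query (.check []))) ?_ rfl,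
    hq.trans (sum_cover_cost_le hν hs.nodup), ?_⟩
  · cases hf : (dictSubsets b Xs).find? fun S => decide (Solvable Q ν G Xs
      (Xs.filter fun x => x ∉ S) b S.length (classSize G Xs (Xs.filter fun x => x ∉ S) [])) with
    | none => rw [hf] at hgo; exact hgo
    | some S => rw [hf] at hgo; exact hgo
  · rw [List.find?_isSome]
    simp

end TwinBranching

/-! ### The number of states -/

/-- The elements of `s` can be told apart with `b` bits. -/
def FitsIn {α : Type} (s : Set α) (b : ℕ) : Prop := s.encard ≤ 2 ^ b

namespace FitsIn

variable {α β γ : Type} {s : Set α} {a b : ℕ}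

theorem mono (h : FitsIn s a) (hab : a ≤ b) : FitsIn s b :=
  le_trans h (by exact_mod_cast Nat.pow_le_pow_right (by norm_num) hab)

theorem subset {t : Set α} (h : FitsIn s a) (hts : t ⊆ s) : FitsIn t a :=
  le_trans (Set.encard_le_encard hts) h

theorem singleton (x : α) : FitsIn {x} 0 := by simp [FitsIn]

theorem union {t : Set α} (hs : FitsIn s b) (ht : FitsIn t b) : FitsIn (s ∪ t) (b + 1) := by
  refine (Set.encard_union_le s t).trans ((add_le_add hs ht).trans (le_of_eq ?_))
  rw [pow_succ, mul_two]

theorem iff_exists : FitsIn s b ↔ ∃ f : Fin (2 ^ b) → Option α, ∀ x ∈ s, ∃ i, f i = some x := by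
  constructor
  · intro h
    have hfin : s.Finite := Set.finite_of_encard_le_coe (k := 2 ^ b) (by exact_mod_cast h)
    have hcard : hfin.toFinset.card ≤ 2 ^ b := by
      have h' : s.encard ≤ 2 ^ b := h
      rw [hfin.encard_eq_coe_toFinset_card] at h'
      exact_mod_cast h'
    let e := hfin.toFinset.equivFin
    refine ⟨fun i => if hi : i.1 < hfin.toFinset.card then some (e.symm ⟨i, hi⟩).1 else none,
      fun x hx => ?_⟩
    have hx' : x ∈ hfin.toFinset := by simpa using hx
    refine ⟨⟨(e ⟨x, hx'⟩).1, (e ⟨x, hx'⟩).2.trans_le hcard⟩, ?_⟩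
    simp
  · rintro ⟨f, hf⟩
    have h1 : some '' s ⊆ Set.range f := by
      rintro _ ⟨x, hx, rfl⟩
      exact hf x hx
    calc s.encard = (some '' s).encard := ((Option.some_injective α).encard_image s).symm
      _ ≤ (Set.range f).encard := Set.encard_le_encard h1
      _ ≤ (Set.univ : Set (Fin (2 ^ b))).encard := by
        rw [← Set.image_univ]
        exact Set.encard_image_le _ _
      _ = 2 ^ b := by simp [Set.encard_univ]

/-- If the elements of `u` are built from an `x` in `s` and a `y` in a set that may depend on `x`,
then it is enough to store `x` and `y`. -/
theorem build {t : α → Set β} {u : Set γ} (hs : FitsIn s a) (ht : ∀ x ∈ s, FitsIn (t x) b)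
    (f : α → β → γ) (hu : ∀ z ∈ u, ∃ x ∈ s, ∃ y ∈ t x, f x y = z) : FitsIn u (a + b) := by
  rw [iff_exists] at hs ⊢
  obtain ⟨g, hg⟩ := hs
  have ht' : ∀ x, ∃ h : Fin (2 ^ b) → Option β, x ∈ s → ∀ y ∈ t x, ∃ i, h i = some y := by
    intro x
    by_cases hx : x ∈ s
    · obtain ⟨h, hh⟩ := iff_exists.1 (ht x hx)
      exact ⟨h, fun _ => hh⟩
    · exact ⟨fun _ => none, fun hx' => absurd hx' hx⟩
  choose h hh using ht'
  let e : Fin (2 ^ (a + b)) ≃ Fin (2 ^ a) × Fin (2 ^ b) :=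
    (finCongr (pow_add 2 a b)).trans finProdFinEquiv.symm
  refine ⟨fun i => (g (e i).1).bind fun x => (h x (e i).2).map fun y => f x y, fun z hz => ?_⟩
  obtain ⟨x, hx, y, hy, rfl⟩ := hu z hz
  obtain ⟨i, hi⟩ := hg x hx
  obtain ⟨j, hj⟩ := hh x hx y hy
  exact ⟨e.symm (i, j), by simp [hi, hj]⟩

theorem build_const {t : Set β} {u : Set γ} (hs : FitsIn s a) (ht : FitsIn t b)
    (f : α → β → γ) (hu : ∀ z ∈ u, ∃ x ∈ s, ∃ y ∈ t, f x y = z) : FitsIn u (a + b) :=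
  build hs (fun _ _ => ht) f hu

theorem of_surj {t : Set β} (hs : FitsIn s a) (f : α → β) (ht : ∀ y ∈ t, ∃ x ∈ s, f x = y) :
    FitsIn t a := by
  refine le_trans (Set.encard_le_encard (t := f '' s) fun y hy => ?_)
    ((Set.encard_image_le f s).trans hs)
  obtain ⟨x, hx, rfl⟩ := ht y hy
  exact ⟨x, hx, rfl⟩

theorem image (hs : FitsIn s a) (f : α → β) : FitsIn (f '' s) a :=
  hs.of_surj f fun _ h => h

theorem option (hs : FitsIn s a) : FitsIn {o : Option α | ∀ x ∈ o, x ∈ s} (a + 1) := by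
  refine subset (union (b := a) ((singleton none).mono (Nat.zero_le a))
    (hs.of_surj (t := some '' s) some fun y hy => hy)) ?_
  rintro (_ | x) hx
  · exact Or.inl rfl
  · exact Or.inr ⟨x, hx x rfl, rfl⟩

theorem list (hs : FitsIn s a) (k : ℕ) :
    FitsIn {l : List α | l.length ≤ k ∧ ∀ x ∈ l, x ∈ s} (k * (a + 1)) := by
  induction k with
  | zero =>
    rw [Nat.zero_mul]
    refine (singleton []).subset fun l hl => ?_
    simpa using hl.1
  | succ k ih =>
    have h := union (b := a + k * (a + 1)) ((singleton ([] : List α)).mono (Nat.zero_le _))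
      (build_const (u := {l : List α | ∃ x ∈ s, ∃ l' : List α,
        (l'.length ≤ k ∧ ∀ x ∈ l', x ∈ s) ∧ x :: l' = l}) hs ih List.cons (by
          rintro _ ⟨x, hx, l, hl, rfl⟩
          exact ⟨x, hx, l, hl, rfl⟩))
    refine (h.subset ?_).mono (by rw [Nat.add_mul]; omega)
    rintro (_ | ⟨x, l⟩) ⟨h1, h2⟩
    · exact Or.inl rfl
    · exact Or.inr ⟨x, h2 x (by simp), l, ⟨by simpa using h1,
        fun y hy => h2 y (List.mem_cons_of_mem _ hy)⟩, rfl⟩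

theorem nat_le {n w : ℕ} (h : n + 1 ≤ 2 ^ w) : FitsIn {i : ℕ | i ≤ n} w := by
  have h1 : {i : ℕ | i ≤ n} = ((Finset.range (n + 1) : Finset ℕ) : Set ℕ) := by
    ext i
    simp
  rw [FitsIn, h1, Set.encard_coe_eq_coe_finsetCard, Finset.card_range]
  exact_mod_cast h

theorem fin {n w : ℕ} (h : n + 1 ≤ 2 ^ w) : FitsIn (Set.univ : Set (Fin n)) w := by
  have h1 : n ≤ 2 ^ w := by omega
  simpa [FitsIn, Set.encard_univ] using (by exact_mod_cast h1 : (n : ℕ∞) ≤ 2 ^ w)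

/-- Multisets with bounded multiplicities, listed in a fixed order of the elements, can be stored
by their multiplicities. -/
theorem sublists_flatMap_replicate {n w : ℕ} (h : n + 1 ≤ 2 ^ w) {c : α → ℕ} (hc : ∀ k, c k ≤ n)
    (D : List α) :
    FitsIn {I : List α | I.Sublist (D.flatMap fun k => List.replicate (c k) k)}
      (D.length * w) := by
  induction D with
  | nil =>
    rw [List.length_nil, Nat.zero_mul]
    refine (singleton []).subset fun l hl => ?_
    simpa using hl
  | cons k D ih =>
    refine (build_const (nat_le h) ih (fun i I => List.replicate i k ++ I) ?_).mono
      (by rw [List.length_cons, Nat.add_mul]; omega)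
    intro I hI
    rw [Set.mem_ofPred_eq, List.flatMap_cons, List.sublist_append_iff] at hI
    obtain ⟨I1, I2, rfl, h1, h2⟩ := hI
    refine ⟨I1.length, ?_, I2, h2, ?_⟩
    · have := h1.length_le
      rw [List.length_replicate] at this
      exact this.trans (hc k)
    · obtain ⟨j, -, rfl⟩ := List.sublist_replicate_iff.1 h1
      simp

theorem functions {n w : ℕ} (h : n + 1 ≤ 2 ^ w) [DecidableEq α] (D : List α) :
    FitsIn {f : α → ℕ | (∀ k, k ∉ D → f k = 0) ∧ ∀ k, f k ≤ n} (D.length * w) := by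
  induction D with
  | nil =>
    rw [List.length_nil, Nat.zero_mul]
    refine (singleton fun _ => 0).subset fun f hf => ?_
    exact funext fun k => hf.1 k (by simp)
  | cons k D ih =>
    refine (build_const (nat_le h) ih (fun i f => Function.update f k i) ?_).mono
      (by rw [List.length_cons, Nat.add_mul]; omega)
    rintro f ⟨h1, h2⟩
    refine ⟨f k, h2 k, Function.update f k 0, ⟨fun k' hk' => ?_, fun k' => ?_⟩, by simp⟩
    · by_cases hkk : k' = k
      · simp [hkk]
      · rw [Function.update_of_ne hkk]
        exact h1 k' (by simp [hkk, hk'])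
    · by_cases hkk : k' = k
      · simp [hkk]
      · rw [Function.update_of_ne hkk]
        exact h2 k'

end FitsIn

namespace TwinBranching

variable {n : ℕ} {A : GraphOracle} {Q : GraphProperty} {ν K w : ℕ} {G : SimpleGraph (Fin n)}
  {L : List (ALToken (Fin n))} {X : List (Fin n)} {b : ℕ} {m : Mem A n}

theorem fitsIn_lists (h : n + 1 ≤ 2 ^ w) (k : ℕ) :
    FitsIn {l : List (Fin n) | l.length ≤ k} (k * (w + 1)) :=
  ((FitsIn.fin h).list k).subset fun _ hl => ⟨hl, fun _ _ => trivial⟩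

/-- The class sizes that can occur, if `D` lists the names of the twin classes. -/
def sizeSet (D : List (Key n)) : Set (Key n → ℕ) := {f | (∀ k, k ∉ D → f k = 0) ∧ ∀ k, f k ≤ n}

/-- The nodes that can occur. -/
def nodeSet (K : ℕ) (D : List (Key n)) : Set (Node n) :=
  {N | N.EC ∈ sizeSet D ∧ (N.stack.length ≤ K ∧ ∀ x ∈ N.stack, x.1.length ≤ K ∧ x.2.length ≤ K) ∧
    ∀ k ∈ N.resume, k.length ≤ K}

/-- The tasks that can occur. -/
def taskSet (K : ℕ) (D : List (Key n)) : Set (Task n) :=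
  {T | match T with
    | .check J => J.length ≤ K
    | .search N J I => N ∈ nodeSet K D ∧ J.length ≤ K ∧
        I.Sublist (D.flatMap fun k => List.replicate (N.EC k) k)}

/-- The memories of a pass that can occur, if the result is in `B`. -/
def readerSet {β : Type} (Y : List (Fin n)) (B : Set β) : Set (Reader n β) :=
  {r | r.acc ∈ B ∧ ∀ c ∈ r.cur, ∀ u ∈ c.2, u ∈ Y}

theorem fitsIn_nodeSet (h : n + 1 ≤ 2 ^ w) (D : List (Key n)) :
    FitsIn (nodeSet K D) (D.length * w + K * (2 * (K * (w + 1)) + 1) + (K * (w + 1) + 1)) := by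
  have hst : FitsIn {x : Key n × List (Fin n) | x.1.length ≤ K ∧ x.2.length ≤ K}
      (2 * (K * (w + 1))) := by
    rw [Nat.two_mul]
    exact FitsIn.build_const (fitsIn_lists h K) (fitsIn_lists h K) Prod.mk
      fun x hx => ⟨x.1, hx.1, x.2, hx.2, rfl⟩
  refine FitsIn.build_const (s := {x : (Key n → ℕ) × List (Key n × List (Fin n)) |
      x.1 ∈ sizeSet D ∧ x.2.length ≤ K ∧ ∀ y ∈ x.2, y.1.length ≤ K ∧ y.2.length ≤ K})
    (FitsIn.build_const (FitsIn.functions h D) (hst.list K) Prod.mk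
      fun x hx => ⟨x.1, hx.1, x.2, hx.2, rfl⟩)
    (fitsIn_lists h K).option (fun x r => ⟨x.1, x.2, r⟩) ?_
  rintro ⟨EC, st, r⟩ ⟨h1, h2, h3⟩
  exact ⟨(EC, st), ⟨h1, h2⟩, r, h3, rfl⟩

theorem fitsIn_taskSet (h : n + 1 ≤ 2 ^ w) (D : List (Key n)) :
    FitsIn (taskSet K D) (D.length * w + K * (2 * (K * (w + 1)) + 1) + (K * (w + 1) + 1) +
      K * (w + 1) + D.length * w + 1) := by
  have h1 : FitsIn {T : Task n | ∃ J : List (Fin n), J.length ≤ K ∧ Task.check J = T}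
      (K * (w + 1)) := (fitsIn_lists h K).of_surj Task.check fun T hT => hT
  have h2 : FitsIn {x : Node n × List (Fin n) | x.1 ∈ nodeSet K D ∧ x.2.length ≤ K} _ :=
    FitsIn.build_const (fitsIn_nodeSet (K := K) h D) (fitsIn_lists h K) Prod.mk
      fun x hx => ⟨x.1, hx.1, x.2, hx.2, rfl⟩
  have h3 : FitsIn {T : Task n | ∃ N ∈ nodeSet K D, ∃ J : List (Fin n), J.length ≤ K ∧
      ∃ I : List (Key n), I.Sublist (D.flatMap fun k => List.replicate (N.EC k) k) ∧
      Task.search N J I = T} _ :=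
    FitsIn.build h2 (t := fun x => {I | I.Sublist (D.flatMap fun k => List.replicate (x.1.EC k) k)})
      (fun x hx => FitsIn.sublists_flatMap_replicate h hx.1.1.2 D)
      (fun x I => Task.search x.1 x.2 I) (by
        rintro _ ⟨N, hN, J, hJ, I, hI, rfl⟩
        exact ⟨(N, J), ⟨hN, hJ⟩, I, hI, rfl⟩)
  refine ((h1.mono (by omega)).union h3).subset ?_
  rintro (J | ⟨N, J, I⟩) hT
  · exact Or.inl ⟨J, hT, rfl⟩
  · exact Or.inr ⟨N, hT.1, J, hT.2.1, I, hT.2.2, rfl⟩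

theorem fitsIn_sublists_of_mem_taskSet (h : n + 1 ≤ 2 ^ w) {D : List (Key n)} {T : Task n}
    (hT : T ∈ taskSet K D) : FitsIn {I : List (Key n) | I.Sublist T.I} (D.length * w) := by
  cases T with
  | check J =>
    refine ((FitsIn.singleton []).subset fun I hI => ?_).mono (Nat.zero_le _)
    exact List.sublist_nil.1 hI
  | search N J I =>
    exact (FitsIn.sublists_flatMap_replicate h hT.1.1.2 D).subset fun I' hI' => hI'.trans hT.2.2

theorem fitsIn_readerSet {β : Type} (h : n + 1 ≤ 2 ^ w) {Y : List (Fin n)} (hY : Y.length ≤ K)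
    {B : Set β} {a : ℕ} (hB : FitsIn B a) :
    FitsIn (readerSet Y B) (a + (w + K * (w + 1) + 1)) := by
  have h1 : FitsIn {c : Fin n × Finset (Fin n) | ∀ u ∈ c.2, u ∈ Y} (w + K * (w + 1)) := by
    refine FitsIn.build_const (FitsIn.fin h) (fitsIn_lists h K) (fun v l => (v, l.toFinset)) ?_
    rintro ⟨v, N⟩ hN
    refine ⟨v, trivial, Y.filter fun u => u ∈ N, (List.length_filter_le _ _).trans hY, ?_⟩
    congr 1
    ext u
    simpa using hN u
  refine FitsIn.build_const hB h1.option (fun a c => ⟨a, c⟩) ?_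
  rintro ⟨a, c⟩ ⟨h2, h3⟩
  exact ⟨a, h2, c, h3, rfl⟩

/-- The phases that can occur, at any moment of a pass. -/
def phaseSet (A : GraphOracle) (ν K : ℕ) (V : ∀ h, Set (A h).State) (Y : List (Fin n))
    (D : List (Key n)) : Set (Phase A n) :=
  {ph | match ph with
    | .start => True
    | .count r => r ∈ readerSet Y (sizeSet D)
    | .pick T r => T ∈ taskSet K D ∧
        r ∈ readerSet Y {x | x.1.Sublist T.I ∧ x.2.length ≤ ν}
    | .ask T W s => T ∈ taskSet K D ∧ W.length ≤ ν ∧ s ∈ V W.length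
    | .delete N k r => N ∈ nodeSet K D ∧ k.length ≤ K ∧
        r ∈ readerSet Y {x | (x.1.length ≤ K ∧ ∀ k ∈ x.1, k.length ≤ K) ∧ x.2.length ≤ K}}

theorem fitsIn_phaseSet (h : n + 1 ≤ 2 ^ w) {V : ∀ h, Set (A h).State} {M : ℕ}
    (hV : ∀ h ≤ ν, FitsIn (V h) M) {Y : List (Fin n)} (hY : Y.length ≤ K) (D : List (Key n)) :
    FitsIn (phaseSet A ν K V Y D) (D.length * w + K * (2 * (K * (w + 1)) + 1) + (K * (w + 1) + 1) +
      K * (w + 1) + D.length * w + 1 + (D.length * w + ν * (w + 1) + (w + K * (w + 1) + 1)) + M +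
      (K * (K * (w + 1) + 1) + K * (w + 1)) + 3) := by
  have h0 : FitsIn ({.start} : Set (Phase A n)) 0 := .singleton _
  have h1 : FitsIn {ph : Phase A n | ∃ r ∈ readerSet Y (sizeSet D), Phase.count r = ph} _ :=
    (fitsIn_readerSet h hY (FitsIn.functions h D)).of_surj Phase.count fun _ hph => hph
  have h2 : FitsIn {ph : Phase A n | ∃ T ∈ taskSet K D,
      ∃ r ∈ readerSet Y {x | x.1.Sublist T.I ∧ x.2.length ≤ ν}, Phase.pick T r = ph} _ :=
    FitsIn.build (fitsIn_taskSet (K := K) h D)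
      (fun T hT => fitsIn_readerSet h hY (FitsIn.build_const
        (u := {x : List (Key n) × List (Fin n) | x.1.Sublist T.I ∧ x.2.length ≤ ν})
        (fitsIn_sublists_of_mem_taskSet h hT) (fitsIn_lists h ν) Prod.mk
        fun x hx => ⟨x.1, hx.1, x.2, hx.2, rfl⟩)) Phase.pick fun _ hph => hph
  have h3 : FitsIn {x : Task n × List (Fin n) | x.1 ∈ taskSet K D ∧ x.2.length ≤ ν} _ :=
    FitsIn.build_const (fitsIn_taskSet (K := K) h D) (fitsIn_lists h ν) Prod.mk
      fun x hx => ⟨x.1, hx.1, x.2, hx.2, rfl⟩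
  have h4 : FitsIn {ph : Phase A n | ∃ T ∈ taskSet K D, ∃ W : List (Fin n), W.length ≤ ν ∧
      ∃ s ∈ V W.length, Phase.ask T W s = ph} _ :=
    -- the type of an oracle state depends on `W`, so the phase is stored in place of the state
    FitsIn.build h3 (t := fun x => Phase.ask (A := A) x.1 x.2 '' V x.2.length)
      (fun x hx => (hV _ hx.2).image _)
      (fun _ ph => ph) (by
        rintro _ ⟨T, hT, W, hW, s, hs, rfl⟩
        exact ⟨(T, W), ⟨hT, hW⟩, _, ⟨s, hs, rfl⟩, rfl⟩)
  have h5 : FitsIn {x : Node n × Key n | x.1 ∈ nodeSet K D ∧ x.2.length ≤ K} _ :=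
    FitsIn.build_const (fitsIn_nodeSet (K := K) h D) (fitsIn_lists h K) Prod.mk
      fun x hx => ⟨x.1, hx.1, x.2, hx.2, rfl⟩
  have h6 : FitsIn {ph : Phase A n | ∃ N ∈ nodeSet K D, ∃ k : Key n, k.length ≤ K ∧
      ∃ r ∈ readerSet Y {x : List (Key n) × List (Fin n) |
        (x.1.length ≤ K ∧ ∀ k ∈ x.1, k.length ≤ K) ∧ x.2.length ≤ K},
      Phase.delete N k r = ph} _ :=
    FitsIn.build_const h5 (fitsIn_readerSet h hY (FitsIn.build_const
        (u := {x : List (Key n) × List (Fin n) |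
          (x.1.length ≤ K ∧ ∀ k ∈ x.1, k.length ≤ K) ∧ x.2.length ≤ K})
        ((fitsIn_lists h K).list K) (fitsIn_lists h K) Prod.mk
        fun x hx => ⟨x.1, hx.1, x.2, hx.2, rfl⟩)) (fun x r => Phase.delete x.1 x.2 r) (by
      rintro _ ⟨N, hN, k, hk, r, hr, rfl⟩
      exact ⟨(N, k), ⟨hN, hk⟩, r, hr, rfl⟩)
  generalize hT : D.length * w + K * (2 * (K * (w + 1)) + 1) + (K * (w + 1) + 1) +
      K * (w + 1) + D.length * w + 1 + (D.length * w + ν * (w + 1) + (w + K * (w + 1) + 1)) + M +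
      (K * (K * (w + 1) + 1) + K * (w + 1)) = t
  refine ((((h0.mono (b := t) (by omega)).union (h1.mono (by omega))).union
    ((h2.mono (b := t) (by omega)).union (h4.mono (by omega)))).union
    (h6.mono (by omega))).subset ?_
  rintro (_ | r | ⟨T, r⟩ | ⟨T, W, s⟩ | ⟨N, k, r⟩) hph
  · exact Or.inl (Or.inl (Or.inl rfl))
  · exact Or.inl (Or.inl (Or.inr ⟨r, hph, rfl⟩))
  · exact Or.inl (Or.inr (Or.inl ⟨T, hph.1, r, hph.2, rfl⟩))
  · exact Or.inl (Or.inr (Or.inr ⟨T, hph.1, W, hph.2.1, s, hph.2.2, rfl⟩))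
  · exact Or.inr ⟨N, hph.1, k, hph.2.1, r, hph.2.2, rfl⟩

end TwinBranching

namespace TwinBranching

variable {n : ℕ} {A : GraphOracle} {Q : GraphProperty} {ν K w : ℕ} {G : SimpleGraph (Fin n)}
  {L : List (ALToken (Fin n))} {X : List (Fin n)} {b : ℕ} {m : Mem A n}

/-- The states in which the oracle can be on graphs with `h` vertices. -/
def oracleStates (A : GraphOracle) (h : ℕ) : Set (A h).State :=
  {s | ∃ x ∈ {x : Unit × List (ALToken (Fin h)) | ∃ H : SimpleGraph (Fin h), IsALStream H x.2},
    ∃ r, (A h).Visits x.1 x.2 s r}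

/-- The states that can occur if the vertex cover has `K` vertices. -/
def memSet (A : GraphOracle) (n ν K : ℕ) : Set (Mem A n) :=
  {m | m.X.Nodup ∧ m.X.length ≤ K ∧ m.budget ≤ K ∧ m.S.length ≤ K ∧
    m.phase ∈ phaseSet A ν K (oracleStates A) (m.X.filter fun x => x ∉ m.S)
      (dictSubsets (m.X.filter fun x => x ∉ m.S).length (m.X.filter fun x => x ∉ m.S))}

theorem classSize_le (Y D : List (Fin n)) (k : Key n) : classSize G X Y D k ≤ n := by
  simpa [classSize] using Finset.card_le_univ
    (Finset.univ.filter fun v => v ∉ X ++ D ∧ classOf G Y v = k)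

theorem classSize_eq_zero {Y : List (Fin n)} (D : List (Fin n)) {k : Key n}
    (hk : k ∉ dictSubsets Y.length Y) : classSize G X Y D k = 0 := by
  rw [classSize, Finset.card_eq_zero, Finset.filter_eq_empty_iff]
  rintro v - ⟨-, rfl⟩
  have h := classOf_sublist G Y v
  exact hk (mem_dictSubsets.2 ⟨h.length_le, h⟩)

/-- As no branching deletes nothing, the depth of the stack is at most the number of deletions. -/
theorem StackGood.length_le {Y : List (Fin n)} {st : List (Key n × List (Fin n))}
    (h : StackGood G X Y st) : st.length ≤ (st.flatMap Prod.snd).length ∧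
      ∀ x ∈ st, x.1.length ≤ Y.length ∧ x.2.length ≤ (st.flatMap Prod.snd).length := by
  induction st with
  | nil => simp
  | cons x st ih =>
    obtain ⟨k, VS⟩ := x
    obtain ⟨h1, -, h3, h4⟩ := h
    obtain ⟨ih1, ih2⟩ := ih h4
    have hpos := List.length_pos_of_ne_nil h1
    rw [List.flatMap_cons, List.length_append, List.length_cons]
    refine ⟨by simp only; omega, fun x hx => ?_⟩
    rcases List.mem_cons.1 hx with rfl | hx
    · obtain ⟨v, hv⟩ := List.exists_mem_of_ne_nil VS h1
      exact ⟨(h3 v hv).2 ▸ (classOf_sublist _ _ _).length_le, Nat.le_add_right _ _⟩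
    · exact ⟨(ih2 x hx).1, (ih2 x hx).2.trans (Nat.le_add_left _ _)⟩

theorem NodeGood.mem_nodeSet {N : Node n} (h : NodeGood G m N) (hb : m.budget ≤ K)
    (hY : m.Y.length ≤ K) : N ∈ nodeSet K (dictSubsets m.Y.length m.Y) := by
  have h1 := h.size_le
  rw [Node.deleted] at h1
  have h2 := h.stack.length_le
  refine ⟨⟨fun k hk => ?_, fun k => ?_⟩, ⟨by omega, fun x hx => ?_⟩, fun k hk => ?_⟩
  · rw [h.sizes, classSize_eq_zero _ hk]
  · rw [h.sizes]
    exact classSize_le _ _ _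
  · have := h2.2 x hx
    omega
  · exact (h.resume k hk).length_le.trans hY

theorem TaskGood.mem_taskSet {T : Task n} (h : TaskGood ν G m T) (hb : m.budget ≤ K)
    (hY : m.Y.length ≤ K) : T ∈ taskSet K (dictSubsets m.Y.length m.Y) := by
  cases T with
  | check J => exact (mem_dictSubsets.1 h).2.length_le.trans hY
  | search N J I =>
    refine ⟨h.1.mem_nodeSet hb hY, (mem_dictSubsets.1 h.2.1).2.length_le.trans hY, ?_⟩
    rw [← flatMap_classes]
    exact (mem_dictPicks.1 h.2.2).2

theorem TaskGood.length_le {T : Task n} (h : TaskGood ν G m T) :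
    T.I.length + T.J.length ≤ ν := by
  cases T with
  | check J => simpa [Task.I, Task.J] using (mem_dictSubsets.1 h).1
  | search N J I =>
    have h1 : J.length ≤ ν := (mem_dictSubsets.1 h.2.1).1
    have h2 := (mem_dictPicks.1 h.2.2).1
    change I.length + J.length ≤ ν
    omega

/-- At every moment of a pass, a collecting reader still wants a part of the classes it wanted at
first, and it has collected one vertex for each of the others. -/
theorem foldl_collect_mem_readerSet (Y Z : List (Fin n)) (I : List (Key n)) (J : List (Fin n))
    (l : List (ALToken (Fin n))) :
    l.foldl (Reader.step Y (collectVertex Z)) ⟨(I, J), none⟩ ∈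
      readerSet Y {x | x.1.Sublist I ∧ x.2.length ≤ I.length + J.length} := by
  obtain ⟨⟨-, -, h1⟩, h2⟩ := Reader.foldl_invariant (Y := Y) (f := collectVertex Z)
    (p := fun _ x => x.1.Sublist I ∧ x.1.length + x.2.length = I.length + J.length)
    (by
      rintro - ⟨R, V⟩ v N ⟨h1, h2⟩
      unfold collectVertex
      split
      · rename_i hv
        refine ⟨List.erase_sublist.trans h1, ?_⟩
        have h3 := List.length_pos_of_mem hv.2
        simp only [List.length_erase_of_mem hv.2, List.length_cons] at h2 h3 ⊢
        omega
      · exact ⟨h1, h2⟩)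
    (a := (I, J)) ⟨List.Sublist.refl _, rfl⟩ l
  exact ⟨⟨h1.1, h1.2 ▸ Nat.le_add_left _ _⟩, h2⟩

theorem foldl_count_mem_readerSet (Y X : List (Fin n)) {l r : List (ALToken (Fin n))}
    (h : IsALStream G (l ++ r)) :
    l.foldl (Reader.step Y (countVertex X)) ⟨fun _ => 0, none⟩ ∈
      readerSet Y (sizeSet (dictSubsets Y.length Y)) := by
  obtain ⟨⟨i, hi, h1⟩, h2⟩ := Reader.foldl_invariant (Y := Y) (f := countVertex X)
    (p := fun i EC => (∀ k, k ∉ dictSubsets Y.length Y → EC k = 0) ∧ ∀ k, EC k ≤ i)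
    (by
      rintro i EC v N ⟨h1, h2⟩
      unfold countVertex
      have hmem : (Y.filter fun y => y ∈ N) ∈ dictSubsets Y.length Y :=
        mem_dictSubsets.2 ⟨List.length_filter_le _ _, List.filter_sublist⟩
      split
      · exact ⟨h1, fun k => (h2 k).trans (Nat.le_succ i)⟩
      · refine ⟨fun k hk => ?_, fun k => ?_⟩
        · rw [Function.update_of_ne (by rintro rfl; exact hk hmem)]
          exact h1 k hk
        · rw [Function.update_apply]
          split
          · exact Nat.succ_le_succ (h2 _)
          · exact (h2 k).trans (Nat.le_succ i))
    (a := fun _ => 0) ⟨fun _ _ => rfl, fun _ => le_rfl⟩ l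
  exact ⟨⟨h1.1, fun k => (h1.2 k).trans (hi.trans (numLists_le_of_isALStream h))⟩, h2⟩

/-- The state after any part `l` of a pass is one of the states that can occur. -/
theorem foldl_mem_memSet (hX : X.Nodup) (hXK : X.length ≤ K) (hb : b ≤ K)
    {l r : List (ALToken (Fin n))} (hL : IsALStream G (l ++ r))
    (hm : MemGood ν G (l ++ r) X b m) : l.foldl Mem.step m ∈ memSet A n ν K := by
  obtain ⟨hbase, hph⟩ := hm
  obtain ⟨rfl, rfl, hS⟩ := hbase
  have hSK := (mem_dictSubsets.1 hS).1.trans hb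
  have hY : m.Y.length ≤ K := (List.length_filter_le _ _).trans hXK
  -- only the phase changes in a pass
  suffices h : ∃ ph ∈ phaseSet A ν K (oracleStates A) m.Y (dictSubsets m.Y.length m.Y),
      l.foldl Mem.step m = { m with phase := ph } by
    obtain ⟨ph, h1, h2⟩ := h
    rw [h2]
    exact ⟨hX, hXK, hb, hSK, h1⟩
  obtain ⟨X, b, S, ph⟩ := m
  cases ph with
  | start => exact hph.elim
  | count r =>
    obtain rfl : r = ⟨fun _ => 0, none⟩ := hph
    exact ⟨_, foldl_count_mem_readerSet _ _ hL, foldl_step_count l ⟨X, b, S, .start⟩ _⟩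
  | pick T r =>
    obtain ⟨hT, rfl⟩ := hph
    refine ⟨_, ?_, foldl_step_pick l ⟨X, b, S, .start⟩ _ _⟩
    refine ⟨hT.mem_taskSet hb hY, ?_⟩
    obtain ⟨h1, h2⟩ := foldl_collect_mem_readerSet (X.filter fun x => x ∉ S)
      ((⟨X, b, S, .start⟩ : Mem A n).unavailable T) T.I T.J l
    exact ⟨⟨h1.1, h1.2.trans hT.length_le⟩, h2⟩
  | ask T W s =>
    obtain ⟨hT, hW, hν, hs⟩ := hph
    refine ⟨_, ?_, foldl_step_ask l ⟨X, b, S, .start⟩ _ _ _⟩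
    refine ⟨hT.mem_taskSet hb hY, hν, ?_⟩
    refine ⟨((), (l ++ r).filterMap (restrictToken W)), ⟨_, isALStream_filterMap hL hW⟩,
      r.filterMap (restrictToken W), StreamAlg.Visits.foldl ?_⟩
    rw [← List.filterMap_append]
    exact hs
  | delete N k r =>
    obtain ⟨hN, hk, c, hc, hck, hbc, rfl⟩ := hph
    have hcK : c ≤ K := by
      simp only at hbc hb
      omega
    have hkK : k.length ≤ K := hk.length_le.trans hY
    refine ⟨_, ?_, foldl_step_delete l ⟨X, b, S, .start⟩ _ _ _⟩
    refine ⟨hN.mem_nodeSet hb hY, hkK, ?_⟩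
    obtain ⟨h1, h2⟩ := foldl_collect_mem_readerSet (X.filter fun x => x ∉ S)
      (X ++ N.deleted) (List.replicate c k) [] l
    rw [Set.mem_ofPred_eq, List.length_replicate] at h1
    refine ⟨⟨⟨?_, fun k' hk' => ?_⟩, h1.2.trans hcK⟩, h2⟩
    · have := h1.1.length_le
      rw [List.length_replicate] at this
      exact this.trans hcK
    · rw [List.eq_of_mem_replicate (h1.1.subset hk')]
      exact hkK

theorem mem_memSet_of_visits {X : Finset (Fin n)} (hX : X.card = K) {ℓ : ℕ}
    (hL : IsALStream G L) {s : Mem A n} {r : List (ALToken (Fin n))}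
    (h : (alg A ν n).Visits (X, ℓ) L s r) : s ∈ memSet A n ν K := by
  have hlen : (X.sort (· ≤ ·)).length ≤ K := (X.length_sort _).le.trans hX.le
  have hb : min ℓ X.card ≤ K := (min_le_right _ _).trans hX.le
  rcases exists_good_of_visits hL h with ⟨rfl, -⟩ | ⟨m, l, rfl, rfl, hm⟩
  · exact ⟨X.sort_nodup _, hlen, hb, Nat.zero_le _, trivial⟩
  · exact foldl_mem_memSet (X.sort_nodup _) hlen hb hL hm

/-- The memory bound, with `w` bits for a vertex or a class size. -/
theorem fitsIn_memSet (h : n + 1 ≤ 2 ^ w) (hw : 1 ≤ w) {M : ℕ}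
    (hM : ∀ h ≤ ν, FitsIn (oracleStates A h) M) :
    FitsIn (memSet A n ν K) (50 * (2 ^ K * w) + 2 * (ν * w) + M) := by
  have h1 : FitsIn {x : (List (Fin n) × ℕ) × List (Fin n) |
      (x.1.1.length ≤ K ∧ x.1.2 ≤ K) ∧ x.2.length ≤ K} (K * (w + 1) + K + K * (w + 1)) :=
    FitsIn.build_const
      (FitsIn.build_const (u := {x : List (Fin n) × ℕ | x.1.length ≤ K ∧ x.2 ≤ K})
        (fitsIn_lists h K) (FitsIn.nat_le (w := K) Nat.lt_two_pow_self) Prod.mk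
        fun x hx => ⟨x.1, hx.1, x.2, hx.2, rfl⟩)
      (fitsIn_lists h K) Prod.mk fun x hx => ⟨x.1, hx.1, x.2, hx.2, rfl⟩
  -- each field is at most a constant times `2 ^ K * w`, as `K ≤ 2 ^ K` and `K * K ≤ 2 * 2 ^ K`
  have hK : K * K ≤ 2 * 2 ^ K := by
    have : ∀ k : ℕ, (k + 3) * (k + 3) ≤ 2 * 2 ^ (k + 3) ∧ 2 * (k + 3) + 1 ≤ 2 ^ (k + 3) := by
      intro k
      induction k with
      | zero => norm_num
      | succ k ih =>
        rw [show k + 1 + 3 = (k + 3) + 1 by ring, pow_succ]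
        constructor <;> nlinarith
    rcases Nat.lt_or_ge K 3 with h | h
    · interval_cases K <;> norm_num
    · obtain ⟨k, rfl⟩ := Nat.exists_eq_add_of_le' h
      exact (this k).1
  have hK1 : K ≤ 2 ^ K := Nat.lt_two_pow_self.le
  have hU : 1 ≤ 2 ^ K := Nat.one_le_two_pow
  have hKw : K * w ≤ 2 ^ K * w := Nat.mul_le_mul_right _ hK1
  have hKKw : K * K * w ≤ 2 * (2 ^ K * w) :=
    (Nat.mul_le_mul_right _ hK).trans (le_of_eq (Nat.mul_assoc _ _ _))
  have hKK : K * K * 1 ≤ K * K * w := Nat.mul_le_mul_left _ hw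
  have hUw : 2 ^ K * 1 ≤ 2 ^ K * w := Nat.mul_le_mul_left _ hw
  have hw1 : 1 * w ≤ 2 ^ K * w := Nat.mul_le_mul_right _ hU
  have hνw : ν * 1 ≤ ν * w := Nat.mul_le_mul_left _ hw
  have h2 : ∀ X : List (Fin n), X.Nodup → X.length ≤ K → ∀ S : List (Fin n),
      FitsIn (phaseSet A ν K (oracleStates A) (X.filter fun x => x ∉ S)
        (dictSubsets (X.filter fun x => x ∉ S).length (X.filter fun x => x ∉ S)))
        (40 * (2 ^ K * w) + 2 * (ν * w) + M) := by
    intro X hX hXK S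
    have hY : (X.filter fun x => x ∉ S).length ≤ K := (List.length_filter_le _ _).trans hXK
    refine (fitsIn_phaseSet h hM hY _).mono ?_
    have hD := (length_dictSubsets_le (hX.filter fun x => x ∉ S)
      (X.filter fun x => x ∉ S).length).trans (Nat.pow_le_pow_right (by norm_num) hY)
    have hDw := Nat.mul_le_mul_right w hD
    have e1 : K * (w + 1) = K * w + K := by ring
    have e2 : K * (2 * (K * (w + 1)) + 1) = 2 * (K * K * w) + 2 * (K * K) + K := by ring
    have e3 : K * (K * (w + 1) + 1) = K * K * w + K * K + K := by ring
    have e4 : ν * (w + 1) = ν * w + ν := by ring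
    rw [e2, e3, e4, e1]
    omega
  refine (FitsIn.build (u := memSet A n ν K)
    (s := {x : (List (Fin n) × ℕ) × List (Fin n) | x.1.1.Nodup ∧
      (x.1.1.length ≤ K ∧ x.1.2 ≤ K) ∧ x.2.length ≤ K})
    (h1.subset fun x hx => hx.2) (fun x hx => h2 x.1.1 hx.1 hx.2.1.1 x.2)
    (fun x ph => ⟨x.1.1, x.1.2, x.2, ph⟩) ?_).mono ?_
  · rintro ⟨X, b, S, ph⟩ ⟨h3, h4, h5, h6, h7⟩
    exact ⟨((X, b), S), ⟨h3, ⟨h4, h5⟩, h6⟩, ph, h7, rfl⟩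
  · have e1 : K * (w + 1) = K * w + K := by ring
    rw [e1]
    omega

/-- The bound on the memory in terms of logarithms. -/
theorem bits_le {n K ν M : ℕ} (hn : 2 ≤ n) :
    ((50 * (2 ^ K * (Nat.log 2 n + 1)) + 2 * (ν * (Nat.log 2 n + 1)) + M : ℕ) : ℝ) ≤
      (100 : ℕ) * (2 ^ K * (K + Real.logb 2 n) + ν * Real.logb 2 n + M) := by
  have h1 : ((Nat.log 2 n : ℕ) : ℝ) ≤ Real.logb 2 n := Real.natLog_le_logb n 2
  have h2 : (1 : ℝ) ≤ Nat.log 2 n := by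
    exact_mod_cast Nat.log_pos (by norm_num) hn
  push_cast
  set l := Real.logb 2 n
  have h3 : (Nat.log 2 n : ℝ) + 1 ≤ 2 * l := by linarith
  have h4 : (2 : ℝ) ^ K * (Nat.log 2 n + 1) ≤ 2 ^ K * (2 * l) := by gcongr
  have h5 : (ν : ℝ) * (Nat.log 2 n + 1) ≤ ν * (2 * l) := by gcongr
  have h6 : (0 : ℝ) ≤ 2 ^ K * K := by positivity
  have h7 : (0 : ℝ) ≤ ν * l := mul_nonneg (Nat.cast_nonneg _) (by linarith)
  have h8 : (0 : ℝ) ≤ M := Nat.cast_nonneg _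
  nlinarith

end TwinBranching

theorem mainTheorem8 :
    ∃ C : ℕ, ∀ (Q : GraphProperty) (ν : ℕ) (A : GraphOracle) (P M : ℕ → ℕ),
      1 ≤ ν →
      (∀ (h : ℕ) (H : SimpleGraph (Fin h)), Q.Mem H → h ≤ ν) →
      (∀ h ≤ ν, A.Decides Q h (P h) (M h)) →
      (∀ h ≤ ν, P h ≤ P ν ∧ M h ≤ M ν) →
      ∀ n K : ℕ, 2 ≤ n →
        (∀ (G : SimpleGraph (Fin n)) (X : Finset (Fin n)) (ℓ : ℕ) (L : List (ALToken (Fin n))),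
          G.IsVertexCover (X : Set (Fin n)) → X.card = K → IsALStream G L →
          ∃ (p : ℕ) (b : Bool),
            (TwinBranching.alg A ν n).Run L ((TwinBranching.alg A ν n).init (X, ℓ)) p b ∧
            p ≤ C * (3 ^ K * ν ^ (K + 1) * 2 ^ (ν * K) * (1 + P ν)) ∧
            ((ℓ ≤ K ∨ ∀ (h : ℕ) (H : SimpleGraph (Fin h)), Q.Mem H → ∃ u v, H.Adj u v) →
              (b = true ↔ Q.Deletable G ℓ))) ∧
        ∃ m : ℕ,
          (TwinBranching.alg A ν n).UsesBits
            {x | ∃ G : SimpleGraph (Fin n), G.IsVertexCover (x.1.1 : Set (Fin n)) ∧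
              x.1.1.card = K ∧ IsALStream G x.2} m ∧
          (m : ℝ) ≤ C * (2 ^ K * (K + Real.logb 2 n) + ν * Real.logb 2 n + M ν) := by
  refine ⟨100, fun Q ν A P M hν hQ hA hPM n K hn => ⟨fun G X ℓ L hX hK hL => ?_, ?_⟩⟩
  · subst hK
    have hs : TwinBranching.Setting A Q ν (P ν) G (X.sort (· ≤ ·)) L := by
      refine ⟨fun h hh H L hL => ?_, fun u v huv => ?_, X.sort_nodup _, hL⟩
      · obtain ⟨q, a, h1, h2, h3⟩ := (hA h hh).1 H L hL
        exact ⟨q, a, h1, h2.trans (hPM h hh).1, h3⟩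
      · simpa using hX huv
    obtain ⟨q, a, h1, h2, h3⟩ := TwinBranching.alg_run hs hν hQ ℓ
    refine ⟨q, a, h1, h2.trans (Nat.mul_le_mul_right _ (by norm_num)), fun h => ?_⟩
    have hlen := X.length_sort (· ≤ ·)
    rw [h3, ← hlen]
    exact TwinBranching.deletable_min_iff hs.cover hs.nodup (by rwa [hlen])
  · refine ⟨_, ?_, TwinBranching.bits_le (ν := ν) (M := M ν) hn⟩
    have hw : n + 1 ≤ 2 ^ (Nat.log 2 n + 1) := Nat.lt_pow_succ_log_self (by norm_num) n
    refine FitsIn.subset (TwinBranching.fitsIn_memSet (A := A) (ν := ν) (K := K) hw (by omega)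
      fun h hh => FitsIn.mono (hA h hh).2 (hPM h hh).2) ?_
    rintro s ⟨x, ⟨G, -, hK, hL⟩, r, hv⟩
    exact TwinBranching.mem_memSet_of_visits hK hL hv
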